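/- Let $n\ge 3$, and for a partition $\lambda\vdash n$ let $p,q,r$ be the numbers of parts of $\lambda$ of size $1,2,3$. For $\mu\vdash n$ let $\chi^{\mu}$ be the irreducible character of the symmetric group $S_n$ indexed by $\mu$ (the character of the Specht module of shape $\mu$), and let $\chi^\mu(\lambda)$ be its value on the permutations of cycle type $\lambda$. Put $$\boldsymbol\chi_7=\bigl(\chi^{(n)},\chi^{(n-1,1)},\chi^{(n-2,2)},\chi^{(n-2,1,1)},\chi^{(n-3,3)},\chi^{(n-3,2,1)},\chi^{(n-3,1,1,1)}\bigr)^{T}.$$ If $n\le 5$ and the index of an entry is not a partition of $n$, that entry denotes the function given by the respective formula $$\chi^{(n-2,2)}(\lambda)=\tbinom{p-1}{2}+q-1,\qquad \chi^{(n-3,3)}(\lambda)=\tbinom{p-1}{3}+(p-1)(q-1)+r,$$ $$\chi^{(n-3,2,1)}(\lambda)=2\tbinom{p-1}{3}-p-r+2,\qquad \chi^{(n-3,1,1,1)}(\lambda)=\tbinom{p-1}{3}-q(p-1)+r,$$ where $\binom{x}{2}=\frac{x(x-1)}{2}$ and $\binom{x}{3}=\frac{x(x-1)(x-2)}{6}$.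 Define \begin{align*} H_{31}(\lambda)&=p(p-1)(p-2), \qquad H_{32}(\lambda)=2pq, \qquad H_{33}(\lambda)=3r,\\ H_{41}(\lambda)&=p(p-1)(n-p), \qquad H_{42}(\lambda)=2q(n-p-2),\\ H_{43}(\lambda)&=p(n-p-2q), \qquad H_{44}(\lambda)=n-p-2q-3r,\\ H_{51}(\lambda)&=p^3+3p^2+2pq-n(2p^2+3p)+n^2p,\\ H_{52}(\lambda)&=p^2+4p+2pq+8q+3r-n(2p+2q+4)+n^2,\\ H_{61}(\lambda)&=-p^3-9p^2-20p-6pq-24q-6r+n(3p^2+18p+6q+20)-n^2(3p+9)+n^3. \end{align*} Then for every $\lambda\vdash n$ \begin{align*} H_{31}(\lambda)&=(1,3,3,3,1,2,1)\,\boldsymbol\chi_7(\lambda),\\ H_{32}(\lambda)&=(1,1,1,-1,1,0,-1)\,\boldsymbol\chi_7(\lambda),\\ H_{33}(\lambda)&=(1,0,0,0,1,-1,1)\,\boldsymbol\chi_7(\lambda),\\ H_{41}(\lambda)&=(n-3,2n-7,n-5,n-5,-1,-2,-1)\,\boldsymbol\chi_7(\lambda),\\ H_{42}(\lambda)&=(n-3,-1,n-3,-n+3,-1,0,1)\,\boldsymbol\chi_7(\lambda),\\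 H_{43}(\lambda)&=(n-3,n-4,-2,0,-1,0,1)\,\boldsymbol\chi_7(\lambda),\\ H_{44}(\lambda)&=(n-3,-1,-1,1,-1,1,-1)\,\boldsymbol\chi_7(\lambda),\\ H_{51}(\lambda)&=(n^2-7n+12,\,n^2-9n+20,\,-2n+10,\,-2n+8,\,2,\,2,\,0)\,\boldsymbol\chi_7(\lambda),\\ H_{52}(\lambda)&=(n^2-7n+12,\,-2n+8,\,-n+6,\,n-4,\,2,\,-1,\,0)\,\boldsymbol\chi_7(\lambda),\\ H_{61}(\lambda)&=(n^3-12n^2+47n-60,\,-3n^2+27n-60,\,6n-30,\,0,\,-6,\,0,\,0)\,\boldsymbol\chi_7(\lambda). \end{align*} Moreover, if $n\le 5$, the entries that are not irreducible characters of $S_n$ can be replaced using $\chi^{(n-3,3)}=0$ if $n=5$; $\chi^{(n-3,3)}=-\chi^{(n-2,2)}$ and $\chi^{(n-3,2,1)}=0$ if $n=4$; $\chi^{(n-2,2)}=0$, $\chi^{(n-3,3)}=-\chi^{(n-1,1)}$, $\chi^{(n-3,2,1)}=-\chi^{(n-2,1,1)}$ and $\chi^{(n-3,1,1,1)}=0$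 if $n=3$. -/

import Mathlib

namespace SymChar

/-! ### Irreducible characters of the symmetric group -/

/-- The Young diagram of a partition `μ` of `n`: the rows have the parts of `μ`, in weakly
decreasing order, as their lengths. -/
def diagram {n : ℕ} (μ : n.Partition) : YoungDiagram :=
  YoungDiagram.ofRowLens (μ.parts.sort (· ≥ ·))
    (Multiset.pairwise_sort μ.parts (· ≥ ·)).sortedGE

theorem card_cellsOfRowLens (w : List ℕ) :
    (YoungDiagram.cellsOfRowLens w).card = w.sum := by
  induction w with
  | nil => rfl
  | cons a w ih =>
    rw [YoungDiagram.cellsOfRowLens, Finset.card_union_of_disjoint]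
    · simp [ih]
    · rw [Finset.disjoint_left]
      rintro ⟨i, j⟩ h1 h2
      simp only [Finset.mem_product, Finset.mem_singleton] at h1
      simp only [Finset.mem_map] at h2
      obtain ⟨⟨a, b⟩, -, h⟩ := h2
      have := congrArg Prod.fst h
      simp at this
      omega

theorem card_diagram {n : ℕ} (μ : n.Partition) : (diagram μ).cells.card = n := by
  change (YoungDiagram.cellsOfRowLens _).card = n
  rw [card_cellsOfRowLens, ← Multiset.sum_coe, Multiset.sort_eq, μ.parts_sum]

/-- A tableau of shape `μ`: a bijection from the entries `Fin n` to the cells `(row, column)`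
of the Young diagram of `μ`. (The bijection is an arbitrary fixed one. Another choice gives an
isomorphic Specht module, hence the same character.) -/
noncomputable def tableau {n : ℕ} (μ : n.Partition) : Fin n ≃ (diagram μ).cells :=
  (Finset.equivFinOfCardEq (card_diagram μ)).symm

/-- The permutations of the entries that preserve each row of the tableau. -/
noncomputable def rowGroup {n : ℕ} (μ : n.Partition) : Finset (Equiv.Perm (Fin n)) :=
  Finset.univ.filter fun g => ∀ i, (tableau μ (g i)).1.1 = (tableau μ i).1.1

/-- The permutations of the entries that preserve each column of the tableau. -/
noncomputable def columnGroup {n : ℕ} (μ : n.Partition) : Finset (Equiv.Perm (Fin n)) :=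
  Finset.univ.filter fun g => ∀ i, (tableau μ (g i)).1.2 = (tableau μ i).1.2

/-- The Young symmetrizer: the sum of `sign(q) · pq` over `p` in the row group and `q` in the
column group, an element of the group algebra `ℂ[S_n]`. -/
noncomputable def youngSymmetrizer {n : ℕ} (μ : n.Partition) :
    MonoidAlgebra ℂ (Equiv.Perm (Fin n)) :=
  ∑ p ∈ rowGroup μ, ∑ q ∈ columnGroup μ,
    MonoidAlgebra.single (p * q) (((Equiv.Perm.sign q : ℤˣ) : ℤ) : ℂ)

/-- The Specht module of shape `μ`: the left ideal of `ℂ[S_n]` generated by the Young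
symmetrizer. It is the irreducible representation of `S_n` indexed by `μ`. -/
noncomputable def spechtModule {n : ℕ} (μ : n.Partition) :
    Ideal (MonoidAlgebra ℂ (Equiv.Perm (Fin n))) :=
  Ideal.span {youngSymmetrizer μ}

/-- The irreducible character `χ^μ` of `S_n`: the trace of the action of `σ` on the Specht
module by left multiplication. -/
noncomputable def irrChar {n : ℕ} (μ : n.Partition) (σ : Equiv.Perm (Fin n)) : ℂ :=
  LinearMap.trace ℂ (spechtModule μ)
    (Algebra.lsmul ℂ ℂ (spechtModule μ) (MonoidAlgebra.of ℂ (Equiv.Perm (Fin n)) σ))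

/-! ### The vector of seven characters -/

/-- The list `rows` is a partition of `n`, written in weakly decreasing order. -/
def IsPartitionOf (rows : List ℕ) (n : ℕ) : Prop :=
  rows.SortedGE ∧ (∀ x ∈ rows, 0 < x) ∧ rows.sum = n

/-- The partition of `n` with the given parts. -/
def toPartition {rows : List ℕ} {n : ℕ} (h : IsPartitionOf rows n) : n.Partition where
  parts := (rows : Multiset ℕ)
  parts_pos := fun {i} hi => h.2.1 i (by simpa using hi)
  parts_sum := by simpa using h.2.2

open Classical in
/-- The function `χ^rows` on `S_n`: if `rows` is a partition of `n`, it is the irreducible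
character with this index, and otherwise it takes the value `other σ`. -/
noncomputable def chiOr {n : ℕ} (rows : List ℕ) (other : Equiv.Perm (Fin n) → ℂ)
    (σ : Equiv.Perm (Fin n)) : ℂ :=
  if h : IsPartitionOf rows n then irrChar (toPartition h) σ else other σ

/-- The number of cycles of length `k` of `σ`, fixed points being the cycles of length 1. -/
def cycles {n : ℕ} (k : ℕ) (σ : Equiv.Perm (Fin n)) : ℕ := σ.partition.parts.count k

/-- The vector `χ₇` whose entries are the functions `χ^{(n)}`, `χ^{(n-1,1)}`, `χ^{(n-2,2)}`,
`χ^{(n-2,1,1)}`, `χ^{(n-3,3)}`, `χ^{(n-3,2,1)}`, `χ^{(n-3,1,1,1)}` on `S_n`, for `n ≥ 3`.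
These are irreducible characters whenever the index is a partition, in particular all of them
for `n ≥ 6`. For `3 ≤ n ≤ 5`, an entry whose index is not a partition (this does not happen for
the first, the second and the fourth one) is by convention the polynomial in the numbers of
cycles of lengths 1, 2, 3 with the same expression as for large `n`. -/
noncomputable def chi7 (n : ℕ) (σ : Equiv.Perm (Fin n)) : Fin 7 → ℂ :=
  ![chiOr [n] (fun _ => 1) σ,
    chiOr [n - 1, 1] (fun σ => (cycles 1 σ : ℂ) - 1) σ,
    chiOr [n - 2, 2] (fun σ =>
      ((cycles 1 σ : ℂ) - 1) * (cycles 1 σ - 2) / 2 + cycles 2 σ - 1) σ,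
    chiOr [n - 2, 1, 1] (fun σ =>
      ((cycles 1 σ : ℂ) - 1) * (cycles 1 σ - 2) / 2 - cycles 2 σ) σ,
    chiOr [n - 3, 3] (fun σ =>
      ((cycles 1 σ : ℂ) - 1) * (cycles 1 σ - 2) * (cycles 1 σ - 3) / 6
        + (cycles 1 σ - 1) * (cycles 2 σ - 1) + cycles 3 σ) σ,
    chiOr [n - 3, 2, 1] (fun σ =>
      2 * (((cycles 1 σ : ℂ) - 1) * (cycles 1 σ - 2) * (cycles 1 σ - 3) / 6)
        - cycles 1 σ - cycles 3 σ + 2) σ,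
    chiOr [n - 3, 1, 1, 1] (fun σ =>
      ((cycles 1 σ : ℂ) - 1) * (cycles 1 σ - 2) * (cycles 1 σ - 3) / 6
        - cycles 2 σ * (cycles 1 σ - 1) + cycles 3 σ) σ]

/-! ### The ten functions `H_{jℓ}` on partitions of `n` -/

/-- The number of parts of size `k` of the partition `lam`, as a complex number. -/
noncomputable def mult {n : ℕ} (lam : n.Partition) (k : ℕ) : ℂ := (lam.parts.count k : ℂ)

noncomputable def H31 {n : ℕ} (lam : n.Partition) : ℂ :=
  let p := mult lam 1;
  p * (p - 1) * (p - 2)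

noncomputable def H32 {n : ℕ} (lam : n.Partition) : ℂ :=
  let p := mult lam 1;
  let q := mult lam 2;
  2 * p * q

noncomputable def H33 {n : ℕ} (lam : n.Partition) : ℂ :=
  let r := mult lam 3;
  3 * r

noncomputable def H41 {n : ℕ} (lam : n.Partition) : ℂ :=
  let p := mult lam 1;
  p * (p - 1) * ((n : ℂ) - p)

noncomputable def H42 {n : ℕ} (lam : n.Partition) : ℂ :=
  let p := mult lam 1;
  let q := mult lam 2;
  2 * q * ((n : ℂ) - p - 2)

noncomputable def H43 {n : ℕ} (lam : n.Partition) : ℂ :=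
  let p := mult lam 1;
  let q := mult lam 2;
  p * ((n : ℂ) - p - 2 * q)

noncomputable def H44 {n : ℕ} (lam : n.Partition) : ℂ :=
  let p := mult lam 1;
  let q := mult lam 2;
  let r := mult lam 3;
  (n : ℂ) - p - 2 * q - 3 * r

noncomputable def H51 {n : ℕ} (lam : n.Partition) : ℂ :=
  let p := mult lam 1;
  let q := mult lam 2;
  p ^ 3 + 3 * p ^ 2 + 2 * p * q - (n : ℂ) * (2 * p ^ 2 + 3 * p) + (n : ℂ) ^ 2 * p

noncomputable def H52 {n : ℕ} (lam : n.Partition) : ℂ :=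
  let p := mult lam 1;
  let q := mult lam 2;
  let r := mult lam 3;
  p ^ 2 + 4 * p + 2 * p * q + 8 * q + 3 * r - (n : ℂ) * (2 * p + 2 * q + 4) + (n : ℂ) ^ 2

noncomputable def H61 {n : ℕ} (lam : n.Partition) : ℂ :=
  let p := mult lam 1;
  let q := mult lam 2;
  let r := mult lam 3;
  -p ^ 3 - 9 * p ^ 2 - 20 * p - 6 * p * q - 24 * q - 6 * r
    + (n : ℂ) * (3 * p ^ 2 + 18 * p + 6 * q + 20) - (n : ℂ) ^ 2 * (3 * p + 9) + (n : ℂ) ^ 3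

end SymChar

/-!
Both sides of the identities are polynomials in `n` and in the numbers `p`, `q`, `r` of cycles of
lengths one, two and three of `σ`, once the seven characters are. So the theorem reduces to the
character polynomials of the shapes `(n - k, …)` with `k ≤ 3`, which have to be derived from the
definition of the Specht module as the left ideal generated by the Young symmetrizer `e`.

*From the Specht module to a sum over the group.* Right multiplication by `e` maps `ℂ[S_n]` onto
the Specht module and acts there by a scalar `c`. Hence `c χ(σ)` is the trace of `x ↦ σ x e` on
`ℂ[S_n]`, which is `∑ h, e(h⁻¹ σ⁻¹ h)` (`smul_trace_spechtModule`, `trace_mul_mul`). The value of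
`c` is not needed: the trace of the column antisymmetrizer on the Specht module is the order of
the column group `C` (`trace_colSum`), that is, `∑ q ∈ C, sign q * χ(q) = |C|`. Therefore a
function `P` is the character if it is proportional to the sum over `h` and satisfies this
normalization (`irrChar_eq_of_sum_eq`). Only the classical combinatorics of rows and columns is
used (`exists_mul_or_exists_collision`), neither irreducibility nor the hook length formula.

*Reduction to a bounded number of cells.* An entry in the top row that is alone in its column is
fixed by the column group, and a permutation preserves all rows as soon as it preserves those
below the top one. So `e(h⁻¹ σ⁻¹ h)` only depends on how `h⁻¹ σ h` acts on the cells below the top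
row, of which there are at most three (`coeff_conj`).

*Averages over the conjugacy class.* The sum over `h` becomes a combination of the probabilities
that a random conjugate of `σ` maps given points, at most three, to given points. They are
rational functions of `n`, `p`, `q`, `r`, determined recursively by the facts that the target of a
point is unique and that the number of fixed points is `p` (`avg_cons_new`, `avg_cons_new_self`),
together with the numbers of fixed points of `σ²` and `σ³`. Summing up gives the constants times
the character polynomials, and the normalization is checked on the column group of the core cells.

For `n ≤ 5` the entries whose index is not a partition are the same polynomials by definition
(`chi7_eq`), and their special values follow by listing the possible triples `(p, q, r)`.
-/

namespace SymChar

/-! ### Rows and columns of a tableau -/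

section Tableau

variable {n : ℕ} (μ : n.Partition)

/-- The row of the entry `x` in the tableau of shape `μ`. -/
noncomputable def rowOf (x : Fin n) : ℕ := (tableau μ x).1.1

/-- The column of the entry `x` in the tableau of shape `μ`. -/
noncomputable def colOf (x : Fin n) : ℕ := (tableau μ x).1.2

variable {μ}

theorem mem_rowGroup {g : Equiv.Perm (Fin n)} :
    g ∈ rowGroup μ ↔ ∀ x, rowOf μ (g x) = rowOf μ x := by
  simp [rowGroup, rowOf]

theorem mem_columnGroup {g : Equiv.Perm (Fin n)} :
    g ∈ columnGroup μ ↔ ∀ x, colOf μ (g x) = colOf μ x := by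
  simp [columnGroup, colOf]

theorem eq_of_rowOf_colOf {x y : Fin n} (hr : rowOf μ x = rowOf μ y)
    (hc : colOf μ x = colOf μ y) : x = y :=
  (tableau μ).injective (Subtype.ext (Prod.ext hr hc))

theorem exists_above (x : Fin n) {i : ℕ} (hi : i ≤ rowOf μ x) :
    ∃ y, colOf μ y = colOf μ x ∧ rowOf μ y = i := by
  have hmem : (i, colOf μ x) ∈ (diagram μ).cells :=
    (diagram μ).isLowerSet (show (i, colOf μ x) ≤ (rowOf μ x, colOf μ x) from ⟨hi, le_rfl⟩)
      (tableau μ x).2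
  exact ⟨(tableau μ).symm ⟨_, hmem⟩, by simp [colOf], by simp [rowOf]⟩

theorem one_mem_rowGroup : (1 : Equiv.Perm (Fin n)) ∈ rowGroup μ := mem_rowGroup.2 fun _ => rfl

theorem one_mem_columnGroup : (1 : Equiv.Perm (Fin n)) ∈ columnGroup μ :=
  mem_columnGroup.2 fun _ => rfl

theorem mul_mem_rowGroup {g h : Equiv.Perm (Fin n)} (hg : g ∈ rowGroup μ) (hh : h ∈ rowGroup μ) :
    g * h ∈ rowGroup μ :=
  mem_rowGroup.2 fun x => (mem_rowGroup.1 hg (h x)).trans (mem_rowGroup.1 hh x)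

theorem mul_mem_columnGroup {g h : Equiv.Perm (Fin n)} (hg : g ∈ columnGroup μ)
    (hh : h ∈ columnGroup μ) : g * h ∈ columnGroup μ :=
  mem_columnGroup.2 fun x => (mem_columnGroup.1 hg (h x)).trans (mem_columnGroup.1 hh x)

theorem inv_mem_rowGroup {g : Equiv.Perm (Fin n)} (hg : g ∈ rowGroup μ) : g⁻¹ ∈ rowGroup μ :=
  mem_rowGroup.2 fun x => by simpa using (mem_rowGroup.1 hg (g⁻¹ x)).symm

theorem inv_mem_columnGroup {g : Equiv.Perm (Fin n)} (hg : g ∈ columnGroup μ) :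
    g⁻¹ ∈ columnGroup μ :=
  mem_columnGroup.2 fun x => by simpa using (mem_columnGroup.1 hg (g⁻¹ x)).symm

theorem eq_one_of_mem_rowGroup_of_mem_columnGroup {g : Equiv.Perm (Fin n)} (hr : g ∈ rowGroup μ)
    (hc : g ∈ columnGroup μ) : g = 1 :=
  Equiv.ext fun x => eq_of_rowOf_colOf (mem_rowGroup.1 hr x) (mem_columnGroup.1 hc x)

theorem swap_mem_rowGroup {x y : Fin n} (h : rowOf μ x = rowOf μ y) :
    Equiv.swap x y ∈ rowGroup μ :=
  mem_rowGroup.2 fun z => by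
    rcases eq_or_ne z x with rfl | hx
    · simp [h]
    rcases eq_or_ne z y with rfl | hy
    · simp [h]
    rw [Equiv.swap_apply_of_ne_of_ne hx hy]

theorem swap_mem_columnGroup {x y : Fin n} (h : colOf μ x = colOf μ y) :
    Equiv.swap x y ∈ columnGroup μ :=
  mem_columnGroup.2 fun z => by
    rcases eq_or_ne z x with rfl | hx
    · simp [h]
    rcases eq_or_ne z y with rfl | hy
    · simp [h]
    rw [Equiv.swap_apply_of_ne_of_ne hx hy]

open Finset in
/-- If `g` sends no two entries of one column into one row, then rearranging each column in the
order of the rows of the images puts every `x` into the row of `g x`. Indeed the rank of `g x`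
within the column of `x` is at most the row of `g x`, and both sum up to the same total. -/
theorem exists_columnGroup_rowOf_eq (g : Equiv.Perm (Fin n))
    (hg : ∀ x y, colOf μ x = colOf μ y → rowOf μ (g x) = rowOf μ (g y) → x = y) :
    ∃ q ∈ columnGroup μ, ∀ x, rowOf μ (q x) = rowOf μ (g x) := by
  classical
  let below : Fin n → Finset (Fin n) := fun x =>
    univ.filter fun y => colOf μ y = colOf μ x ∧ rowOf μ (g y) < rowOf μ (g x)
  have hle : ∀ x, (below x).card ≤ rowOf μ (g x) := fun x => by
    rw [← card_range (rowOf μ (g x))]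
    refine card_le_card_of_injOn (fun y => rowOf μ (g y)) (fun y hy => ?_) fun y hy z hz h => ?_
    · simp [below] at hy
      simpa using hy.2
    · simp [below] at hy hz
      exact hg y z (hy.1.trans hz.1.symm) h
  have hex : ∀ x, ∃ y, colOf μ y = colOf μ x ∧ rowOf μ y = (below x).card := fun x => by
    by_contra! hne
    have hlt : ∀ y, colOf μ y = colOf μ x → rowOf μ y < (below x).card := fun y hy => by
      by_contra! hy'
      obtain ⟨z, hz, hz'⟩ := exists_above y hy'
      exact hne z (hz.trans hy) hz'
    have h1 : (univ.filter fun y => colOf μ y = colOf μ x).card ≤ (below x).card := by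
      conv_rhs => rw [← card_range (below x).card]
      refine card_le_card_of_injOn (rowOf μ) (fun y hy => ?_) fun y hy z hz h => ?_
      · simpa using hlt y (by simpa using hy)
      · simp at hy hz
        exact eq_of_rowOf_colOf h (hy.trans hz.symm)
    have h2 : (below x).card < (univ.filter fun y => colOf μ y = colOf μ x).card := by
      refine card_lt_card ⟨fun y hy => ?_, fun h => ?_⟩
      · simp [below] at hy ⊢
        exact hy.1
      · have := h (show x ∈ _ by simp)
        simp [below] at this
    omega
  choose f hf using hex
  have hinj : Function.Injective f := fun x y hxy => by
    have hc : colOf μ x = colOf μ y := by rw [← (hf x).1, ← (hf y).1, hxy]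
    have hs : (below x).card = (below y).card := by rw [← (hf x).2, ← (hf y).2, hxy]
    have key : ∀ x y, colOf μ x = colOf μ y → rowOf μ (g x) < rowOf μ (g y) →
        (below x).card < (below y).card := fun x y hc hr => by
      refine card_lt_card ⟨fun z hz => ?_, fun h => ?_⟩
      · simp [below] at hz ⊢
        exact ⟨hz.1.trans hc, hz.2.trans hr⟩
      · have := h (show x ∈ _ by simp [below, hc, hr])
        simp [below] at this
    refine hg x y hc ?_
    rcases lt_trichotomy (rowOf μ (g x)) (rowOf μ (g y)) with h | h | h
    · exact absurd hs (key x y hc h).ne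
    · exact h
    · exact absurd hs (key y x hc.symm h).ne'
  let q : Equiv.Perm (Fin n) := Equiv.ofBijective f (Finite.injective_iff_bijective.1 hinj)
  have hsum : ∑ x, rowOf μ (q x) = ∑ x, rowOf μ (g x) := by
    rw [Equiv.sum_comp q, Equiv.sum_comp g]
  have hrow : ∀ x, rowOf μ (q x) ≤ rowOf μ (g x) := fun x => (hf x).2.trans_le (hle x)
  exact ⟨q, mem_columnGroup.2 fun x => (hf x).1,
    fun x => (sum_eq_sum_iff_of_le fun x _ => hrow x).1 hsum x (mem_univ x)⟩

/-- Either `g` factors through the row and the column group, or it sends two entries of one column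
to one row. -/
theorem exists_mul_or_exists_collision (g : Equiv.Perm (Fin n)) :
    (∃ p ∈ rowGroup μ, ∃ q ∈ columnGroup μ, g = p * q) ∨
      ∃ x y, x ≠ y ∧ colOf μ x = colOf μ y ∧ rowOf μ (g x) = rowOf μ (g y) := by
  by_cases h : ∃ x y, x ≠ y ∧ colOf μ x = colOf μ y ∧ rowOf μ (g x) = rowOf μ (g y)
  · exact Or.inr h
  · push Not at h
    obtain ⟨q, hq, hqg⟩ := exists_columnGroup_rowOf_eq g fun x y hc hr =>
      by_contra fun hne => h x y hne hc hr
    refine Or.inl ⟨g * q⁻¹, mem_rowGroup.2 fun x => ?_, q, hq, by simp⟩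
    simpa using (hqg (q⁻¹ x)).symm

end Tableau

/-! ### The trace of a permutation on the Specht module -/

section Trace

open MonoidAlgebra

variable {n : ℕ} (μ : n.Partition)

/-- The row symmetrizer, the sum of the elements of the row group. -/
noncomputable def rowSum : MonoidAlgebra ℂ (Equiv.Perm (Fin n)) :=
  ∑ p ∈ rowGroup μ, of ℂ _ p

/-- The column antisymmetrizer, the signed sum of the elements of the column group. -/
noncomputable def colSum : MonoidAlgebra ℂ (Equiv.Perm (Fin n)) :=
  ∑ q ∈ columnGroup μ, ((Equiv.Perm.sign q : ℤ) : ℂ) • of ℂ _ q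

theorem youngSymmetrizer_eq : youngSymmetrizer μ = rowSum μ * colSum μ := by
  simp [youngSymmetrizer, rowSum, colSum, Finset.sum_mul_sum, single_mul_single]

variable {μ}

theorem rowSum_mul_of {p : Equiv.Perm (Fin n)} (hp : p ∈ rowGroup μ) :
    rowSum μ * of ℂ _ p = rowSum μ := by
  rw [rowSum, Finset.sum_mul]
  refine Finset.sum_bij' (fun g _ => g * p) (fun g _ => g * p⁻¹)
    (fun g hg => mul_mem_rowGroup hg hp) (fun g hg => mul_mem_rowGroup hg (inv_mem_rowGroup hp))
    (by simp) (by simp) fun g _ => by rw [map_mul]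

theorem of_mul_rowSum {p : Equiv.Perm (Fin n)} (hp : p ∈ rowGroup μ) :
    of ℂ _ p * rowSum μ = rowSum μ := by
  rw [rowSum, Finset.mul_sum]
  refine Finset.sum_bij' (fun g _ => p * g) (fun g _ => p⁻¹ * g)
    (fun g hg => mul_mem_rowGroup hp hg) (fun g hg => mul_mem_rowGroup (inv_mem_rowGroup hp) hg)
    (by simp) (by simp) fun g _ => by rw [map_mul]

theorem sign_mul_self (q : Equiv.Perm (Fin n)) :
    ((Equiv.Perm.sign q : ℤ) : ℂ) * ((Equiv.Perm.sign q : ℤ) : ℂ) = 1 := by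
  rw [← Int.cast_mul, ← Units.val_mul, Int.units_mul_self]; simp

theorem colSum_mul_of {q : Equiv.Perm (Fin n)} (hq : q ∈ columnGroup μ) :
    colSum μ * of ℂ _ q = ((Equiv.Perm.sign q : ℤ) : ℂ) • colSum μ := by
  rw [colSum, Finset.sum_mul, Finset.smul_sum]
  refine Finset.sum_bij' (fun g _ => g * q) (fun g _ => g * q⁻¹)
    (fun g hg => mul_mem_columnGroup hg hq)
    (fun g hg => mul_mem_columnGroup hg (inv_mem_columnGroup hq))
    (by simp) (by simp) fun g _ => ?_
  rw [map_mul, map_mul, smul_mul_assoc, smul_smul, Units.val_mul, Int.cast_mul,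
    mul_left_comm, sign_mul_self, mul_one]

theorem of_mul_colSum {q : Equiv.Perm (Fin n)} (hq : q ∈ columnGroup μ) :
    of ℂ _ q * colSum μ = ((Equiv.Perm.sign q : ℤ) : ℂ) • colSum μ := by
  rw [colSum, Finset.mul_sum, Finset.smul_sum]
  refine Finset.sum_bij' (fun g _ => q * g) (fun g _ => q⁻¹ * g)
    (fun g hg => mul_mem_columnGroup hq hg)
    (fun g hg => mul_mem_columnGroup (inv_mem_columnGroup hq) hg)
    (by simp) (by simp) fun g _ => ?_
  rw [map_mul, map_mul, mul_smul_comm, smul_smul, Units.val_mul, Int.cast_mul,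
    ← mul_assoc, sign_mul_self, one_mul]

theorem colSum_mul_colSum :
    colSum μ * colSum μ = ((columnGroup μ).card : ℂ) • colSum μ := by
  conv_lhs => lhs; rw [colSum]
  rw [Finset.sum_mul, Finset.sum_congr rfl fun q hq => by
    rw [smul_mul_assoc, of_mul_colSum hq, smul_smul, sign_mul_self, one_smul]]
  rw [Finset.sum_const, Nat.cast_smul_eq_nsmul]

theorem colSum_mul_swap {x y : Fin n} (hxy : x ≠ y) (h : colOf μ x = colOf μ y) :
    colSum μ * of ℂ _ (Equiv.swap x y) = -colSum μ := by
  rw [colSum_mul_of (swap_mem_columnGroup h), Equiv.Perm.sign_swap hxy]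
  simp

theorem swap_mul_colSum {x y : Fin n} (hxy : x ≠ y) (h : colOf μ x = colOf μ y) :
    of ℂ _ (Equiv.swap x y) * colSum μ = -colSum μ := by
  rw [of_mul_colSum (swap_mem_columnGroup h), Equiv.Perm.sign_swap hxy]
  simp

theorem eq_zero_of_eq_neg {x : MonoidAlgebra ℂ (Equiv.Perm (Fin n))} (h : x = -x) : x = 0 := by
  have h2 : (2 : ℂ) • x = 0 := by rw [two_smul]; nth_rewrite 2 [h]; exact add_neg_cancel x
  exact (smul_eq_zero.1 h2).resolve_left two_ne_zero

/-- If two entries of one column are sent by `g` to one row, the transpositions of the two entries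
and of their images cancel `rowSum μ * g * colSum μ`; otherwise `g` is a product `p * q`. -/
theorem rowSum_mul_mul_colSum (x : MonoidAlgebra ℂ (Equiv.Perm (Fin n))) :
    ∃ c : ℂ, rowSum μ * x * colSum μ = c • (rowSum μ * colSum μ) := by
  induction x using MonoidAlgebra.induction_on with
  | of g =>
    rcases exists_mul_or_exists_collision (μ := μ) g with ⟨p, hp, q, hq, rfl⟩ | ⟨x, y, hxy, hc, hr⟩
    · refine ⟨((Equiv.Perm.sign q : ℤ) : ℂ), ?_⟩
      rw [map_mul, ← mul_assoc, rowSum_mul_of hp, mul_assoc, of_mul_colSum hq, mul_smul_comm]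
    · refine ⟨0, ?_⟩
      have h : rowSum μ * of ℂ _ g * colSum μ = -(rowSum μ * of ℂ _ g * colSum μ) := by
        conv_lhs => rw [← rowSum_mul_of (swap_mem_rowGroup hr), mul_assoc (rowSum μ), ← map_mul,
          ← Equiv.mul_swap_eq_swap_mul, map_mul, ← mul_assoc, mul_assoc, swap_mul_colSum hxy hc,
          mul_neg]
      rw [zero_smul]
      exact eq_zero_of_eq_neg h
  | add x y hx hy =>
    obtain ⟨c, hc⟩ := hx
    obtain ⟨d, hd⟩ := hy
    exact ⟨c + d, by rw [mul_add, add_mul, hc, hd, add_smul]⟩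
  | smul r x hx =>
    obtain ⟨c, hc⟩ := hx
    exact ⟨r * c, by rw [mul_smul_comm, smul_mul_assoc, hc, smul_smul]⟩

theorem colSum_mul_mul_rowSum (x : MonoidAlgebra ℂ (Equiv.Perm (Fin n))) :
    ∃ c : ℂ, colSum μ * x * rowSum μ = c • (colSum μ * rowSum μ) := by
  induction x using MonoidAlgebra.induction_on with
  | of g =>
    rcases exists_mul_or_exists_collision (μ := μ) g⁻¹ with
      ⟨p, hp, q, hq, h⟩ | ⟨x, y, hxy, hc, hr⟩
    · refine ⟨((Equiv.Perm.sign q⁻¹ : ℤ) : ℂ), ?_⟩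
      rw [← inv_inv g, h, mul_inv_rev, map_mul, ← mul_assoc,
        colSum_mul_of (inv_mem_columnGroup hq), mul_assoc, of_mul_rowSum (inv_mem_rowGroup hp),
        smul_mul_assoc]
    · refine ⟨0, ?_⟩
      have h : colSum μ * of ℂ _ g * rowSum μ = -(colSum μ * of ℂ _ g * rowSum μ) := by
        conv_lhs => rw [← of_mul_rowSum (swap_mem_rowGroup hr), ← mul_assoc, mul_assoc (colSum μ),
          ← map_mul, Equiv.mul_swap_eq_swap_mul, show g (g⁻¹ x) = x from g.apply_symm_apply x,
          show g (g⁻¹ y) = y from g.apply_symm_apply y, map_mul, ← mul_assoc,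
          colSum_mul_swap hxy hc, neg_mul, neg_mul]
      rw [zero_smul]
      exact eq_zero_of_eq_neg h
  | add x y hx hy =>
    obtain ⟨c, hc⟩ := hx
    obtain ⟨d, hd⟩ := hy
    exact ⟨c + d, by rw [mul_add, add_mul, hc, hd, add_smul]⟩
  | smul r x hx =>
    obtain ⟨c, hc⟩ := hx
    exact ⟨r * c, by rw [mul_smul_comm, smul_mul_assoc, hc, smul_smul]⟩

theorem coeff_youngSymmetrizer (g : Equiv.Perm (Fin n)) :
    (youngSymmetrizer μ).coeff g =
      ∑ q ∈ columnGroup μ, if g * q⁻¹ ∈ rowGroup μ then ((Equiv.Perm.sign q : ℤ) : ℂ) else 0 := by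
  rw [youngSymmetrizer, Finset.sum_comm, coeff_sum, Finset.sum_apply']
  refine Finset.sum_congr rfl fun q _ => ?_
  rw [coeff_sum, Finset.sum_apply']
  simp only [coeff_single, Finsupp.single_apply]
  simp_rw [← eq_mul_inv_iff_mul_eq]
  simp

theorem coeff_youngSymmetrizer_one : (youngSymmetrizer μ).coeff 1 = 1 := by
  rw [coeff_youngSymmetrizer, Finset.sum_eq_single_of_mem 1 one_mem_columnGroup]
  · simp [one_mem_rowGroup]
  · intro q hq hq1
    rw [if_neg]
    intro h
    rw [one_mul] at h
    exact hq1 (inv_eq_one.1 (eq_one_of_mem_rowGroup_of_mem_columnGroup h (inv_mem_columnGroup hq)))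

theorem youngSymmetrizer_ne_zero : youngSymmetrizer μ ≠ 0 := by
  intro h
  have := coeff_youngSymmetrizer_one (μ := μ)
  simp [h] at this

theorem exists_youngSymmetrizer_mul_self :
    ∃ c : ℂ, youngSymmetrizer μ * youngSymmetrizer μ = c • youngSymmetrizer μ := by
  obtain ⟨c, hc⟩ := rowSum_mul_mul_colSum (μ := μ) (colSum μ * rowSum μ)
  exact ⟨c, by rw [youngSymmetrizer_eq, ← hc]; simp only [mul_assoc]⟩

/-- The trace of `x ↦ s * x * e`, computed in the basis of permutations. -/
theorem trace_mul_mul (s e : MonoidAlgebra ℂ (Equiv.Perm (Fin n))) :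
    LinearMap.trace ℂ _ (LinearMap.mulRight ℂ e ∘ₗ LinearMap.mulLeft ℂ s) =
      ∑ h : Equiv.Perm (Fin n), (s * of ℂ _ h * e).coeff h := by
  rw [LinearMap.trace_eq_matrix_trace ℂ (MonoidAlgebra.basis (Equiv.Perm (Fin n)) ℂ),
    Matrix.trace]
  refine Finset.sum_congr rfl fun h _ => ?_
  rw [Matrix.diag_apply, LinearMap.toMatrix_apply, MonoidAlgebra.basis_apply]
  rfl

theorem youngSymmetrizer_mem : youngSymmetrizer μ ∈ spechtModule μ :=
  Ideal.subset_span rfl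

/-- Right multiplication by the Young symmetrizer maps `ℂ[S_n]` onto the Specht module and acts on
it by the scalar `c`, so traces on the Specht module are traces on `ℂ[S_n]` divided by `c`. -/
theorem smul_trace_spechtModule {c : ℂ}
    (hc : youngSymmetrizer μ * youngSymmetrizer μ = c • youngSymmetrizer μ)
    (s : MonoidAlgebra ℂ (Equiv.Perm (Fin n))) :
    c * LinearMap.trace ℂ (spechtModule μ) (Algebra.lsmul ℂ ℂ (spechtModule μ) s) =
      LinearMap.trace ℂ _
        (LinearMap.mulRight ℂ (youngSymmetrizer μ) ∘ₗ LinearMap.mulLeft ℂ s) := by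
  let i : spechtModule μ →ₗ[ℂ] MonoidAlgebra ℂ (Equiv.Perm (Fin n)) :=
    (spechtModule μ).subtype.restrictScalars ℂ
  let r : MonoidAlgebra ℂ (Equiv.Perm (Fin n)) →ₗ[ℂ] spechtModule μ :=
    { toFun := fun x => ⟨x * youngSymmetrizer μ, Ideal.mul_mem_left _ _ youngSymmetrizer_mem⟩
      map_add' := fun x y => Subtype.ext (add_mul _ _ _)
      map_smul' := fun t x => Subtype.ext (smul_mul_assoc _ _ _) }
  have : Module.Finite ℂ (MonoidAlgebra ℂ (Equiv.Perm (Fin n))) :=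
    Module.Finite.of_basis (MonoidAlgebra.basis _ ℂ)
  have : Module.Finite ℂ (spechtModule μ) :=
    Module.Finite.of_injective i Subtype.val_injective
  have h1 : LinearMap.mulRight ℂ (youngSymmetrizer μ) ∘ₗ LinearMap.mulLeft ℂ s =
      i ∘ₗ (r ∘ₗ LinearMap.mulLeft ℂ s) := rfl
  rw [h1, LinearMap.trace_comp_comm' (r ∘ₗ LinearMap.mulLeft ℂ s) i, ← smul_eq_mul, ← map_smul]
  congr 1
  ext w : 1
  obtain ⟨y, hy⟩ := Ideal.mem_span_singleton'.1 w.2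
  refine Subtype.ext ?_
  change c • (s * w.1) = s * w.1 * youngSymmetrizer μ
  rw [← hy, mul_assoc s, mul_assoc y, hc, mul_smul_comm, mul_smul_comm]

/-- The linear map `x ↦ b x e`, where `b` is the column antisymmetrizer and `e` the Young
symmetrizer, is `|C| c` times a projection onto the line spanned by `b e`. -/
theorem trace_colSum {c : ℂ} (hc0 : c ≠ 0)
    (hc : youngSymmetrizer μ * youngSymmetrizer μ = c • youngSymmetrizer μ) :
    LinearMap.trace ℂ _
        (LinearMap.mulRight ℂ (youngSymmetrizer μ) ∘ₗ LinearMap.mulLeft ℂ (colSum μ)) =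
      c * (columnGroup μ).card := by
  have hC : ((columnGroup μ).card : ℂ) ≠ 0 :=
    Nat.cast_ne_zero.2 (Finset.card_ne_zero_of_mem one_mem_columnGroup)
  have : Module.Finite ℂ (MonoidAlgebra ℂ (Equiv.Perm (Fin n))) :=
    Module.Finite.of_basis (MonoidAlgebra.basis _ ℂ)
  set v := colSum μ * youngSymmetrizer μ with hv
  have hv0 : v ≠ 0 := by
    intro h
    have h1 : rowSum μ * v = c • youngSymmetrizer μ := by
      rw [hv, ← hc, ← mul_assoc, ← youngSymmetrizer_eq]
    rw [h, mul_zero] at h1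
    exact smul_ne_zero hc0 youngSymmetrizer_ne_zero h1.symm
  have hproj : LinearMap.IsProj (Submodule.span ℂ {v}) ((c * (columnGroup μ).card)⁻¹ •
      (LinearMap.mulRight ℂ (youngSymmetrizer μ) ∘ₗ LinearMap.mulLeft ℂ (colSum μ))) := by
    constructor
    · intro x
      obtain ⟨d, hd⟩ := colSum_mul_mul_rowSum (μ := μ) x
      refine Submodule.smul_mem _ _ (Submodule.mem_span_singleton.2 ⟨d, ?_⟩)
      change d • v = colSum μ * x * youngSymmetrizer μ
      rw [hv, youngSymmetrizer_eq, ← mul_assoc, ← mul_assoc, hd, smul_mul_assoc]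
    · intro x hx
      obtain ⟨d, rfl⟩ := Submodule.mem_span_singleton.1 hx
      change (c * (columnGroup μ).card)⁻¹ • (colSum μ * (d • v) * youngSymmetrizer μ) = d • v
      rw [mul_smul_comm, smul_mul_assoc, hv, ← mul_assoc, colSum_mul_colSum, smul_mul_assoc,
        smul_mul_assoc, mul_assoc, hc, mul_smul_comm, smul_smul, smul_smul, smul_smul]
      field_simp
  have h := hproj.trace
  rw [map_smul, finrank_span_singleton hv0, smul_eq_mul, Nat.cast_one] at h
  rwa [inv_mul_eq_one₀ (mul_ne_zero hc0 hC), eq_comm] at h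

theorem coeff_of_mul_of_mul (σ h : Equiv.Perm (Fin n))
    (e : MonoidAlgebra ℂ (Equiv.Perm (Fin n))) :
    (of ℂ _ σ * of ℂ _ h * e).coeff h = e.coeff (h⁻¹ * σ⁻¹ * h) := by
  rw [← map_mul, of_apply, ← mul_inv_rev]
  simp [coeff_single_mul_apply]

/-- A criterion that identifies the irreducible character: it is the only multiple `P` of the
function `σ ↦ ∑ h, e(h⁻¹ σ⁻¹ h)`, where `e` is the Young symmetrizer, whose signed sum over the
column group is the order of that group. -/
theorem irrChar_eq_of_sum_eq {K : ℂ} {P : Equiv.Perm (Fin n) → ℂ}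
    (hF : ∀ σ, ∑ h : Equiv.Perm (Fin n), (youngSymmetrizer μ).coeff (h⁻¹ * σ⁻¹ * h) = K * P σ)
    (hP : ∑ q ∈ columnGroup μ, ((Equiv.Perm.sign q : ℤ) : ℂ) * P q = (columnGroup μ).card)
    (σ : Equiv.Perm (Fin n)) : irrChar μ σ = P σ := by
  obtain ⟨c, hc⟩ := exists_youngSymmetrizer_mul_self (μ := μ)
  have hχ : ∀ σ, c * irrChar μ σ = K * P σ := fun σ => by
    rw [irrChar, smul_trace_spechtModule hc, trace_mul_mul, ← hF]
    exact Finset.sum_congr rfl fun h _ => coeff_of_mul_of_mul _ _ _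
  -- At the identity every summand is `1`, so the trace of right multiplication by `e` is `n!`.
  have hc0 : c ≠ 0 := by
    rintro rfl
    have h1 := hF 1
    rw [← hχ 1, zero_mul] at h1
    simp [coeff_youngSymmetrizer_one] at h1
  have hC : ((columnGroup μ).card : ℂ) ≠ 0 :=
    Nat.cast_ne_zero.2 (Finset.card_ne_zero_of_mem one_mem_columnGroup)
  have hK : K = c := by
    refine mul_right_cancel₀ hC ?_
    rw [← trace_colSum hc0 hc, ← smul_trace_spechtModule hc, colSum, map_sum, map_sum,
      Finset.mul_sum, ← hP, Finset.mul_sum]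
    refine Finset.sum_congr rfl fun q _ => ?_
    rw [map_smul, map_smul, smul_eq_mul, mul_left_comm, mul_left_comm c]
    congr 1
    exact (hχ q).symm
  exact mul_left_cancel₀ hc0 (by rw [hχ, hK])

end Trace

/-! ### Reduction to the cells that matter -/

section Core

variable {n m : ℕ} {μ : n.Partition} {z : Fin m ↪ Fin n} {ρ κ : Fin m → ℕ}

/-- The entries `z 0, …, z (m - 1)` form a core of the tableau of shape `μ`: `z i` lies in row
`ρ i` and column `κ i`, and each entry outside the core lies in the top row and is alone in its
column. -/
structure IsCore (μ : n.Partition) (z : Fin m ↪ Fin n) (ρ κ : Fin m → ℕ) : Prop where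
  row : ∀ i, rowOf μ (z i) = ρ i
  col : ∀ i, colOf μ (z i) = κ i
  row_compl : ∀ x, x ∉ Set.range z → rowOf μ x = 0
  col_compl : ∀ x y, x ∉ Set.range z → colOf μ x = colOf μ y → x = y

/-- The permutations of the core that preserve the columns `κ`. -/
def coreColGroup (κ : Fin m → ℕ) : Finset (Equiv.Perm (Fin m)) :=
  Finset.univ.filter fun q => ∀ i, κ (q i) = κ i

/-- The entry at `(x, y)` of the permutation matrix of `h⁻¹ * σ * h`. -/
def entry (σ h : Equiv.Perm (Fin n)) (x y : Fin n) : ℂ := if σ (h x) = h y then 1 else 0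

/-- The coefficient of the Young symmetrizer at the inverse of `h⁻¹ * σ * h`, in terms of the core
(see `coeff_conj`). -/
noncomputable def coreSum (z : Fin m ↪ Fin n) (ρ κ : Fin m → ℕ) (σ h : Equiv.Perm (Fin n)) : ℂ :=
  ∑ q ∈ coreColGroup κ, ((Equiv.Perm.sign q : ℤ) : ℂ) *
    ∏ i with ρ i ≠ 0, ∑ l with ρ l = ρ i, entry σ h (z i) (z (q l))

theorem via_mem_columnGroup (hz : IsCore μ z ρ κ) {q : Equiv.Perm (Fin m)}
    (hq : q ∈ coreColGroup κ) : q.viaFintypeEmbedding z ∈ columnGroup μ :=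
  mem_columnGroup.2 fun x => by
    by_cases hx : x ∈ Set.range z
    · obtain ⟨i, rfl⟩ := hx
      rw [Equiv.Perm.viaFintypeEmbedding_apply_image, hz.col, hz.col]
      exact (Finset.mem_filter.1 hq).2 i
    · rw [Equiv.Perm.viaFintypeEmbedding_apply_notMem_range _ _ hx]

theorem exists_via_eq (hz : IsCore μ z ρ κ) {g : Equiv.Perm (Fin n)} (hg : g ∈ columnGroup μ) :
    ∃ q ∈ coreColGroup κ, q.viaFintypeEmbedding z = g := by
  have hmem : ∀ i, ∃ j, z j = g (z i) := fun i => by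
    by_contra h
    have := hz.col_compl (g (z i)) (z i) h (mem_columnGroup.1 hg _)
    exact h ⟨i, this.symm⟩
  choose f hf using hmem
  have hinj : Function.Injective f := fun i j hij =>
    z.injective (g.injective (by rw [← hf, ← hf, hij]))
  refine ⟨Equiv.ofBijective f (Finite.injective_iff_bijective.1 hinj),
    Finset.mem_filter.2 ⟨Finset.mem_univ _, fun i => ?_⟩, Equiv.ext fun x => ?_⟩
  · rw [Equiv.ofBijective_apply, ← hz.col, ← hz.col, hf]
    exact mem_columnGroup.1 hg _
  · by_cases hx : x ∈ Set.range z
    · obtain ⟨i, rfl⟩ := hx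
      rw [Equiv.Perm.viaFintypeEmbedding_apply_image, Equiv.ofBijective_apply, hf]
    · rw [Equiv.Perm.viaFintypeEmbedding_apply_notMem_range _ _ hx]
      exact hz.col_compl x (g x) hx (mem_columnGroup.1 hg x).symm

theorem sum_columnGroup (hz : IsCore μ z ρ κ) (f : Equiv.Perm (Fin n) → ℂ) :
    ∑ g ∈ columnGroup μ, f g = ∑ q ∈ coreColGroup κ, f (q.viaFintypeEmbedding z) := by
  refine (Finset.sum_bij (fun q _ => q.viaFintypeEmbedding z)
    (fun q hq => via_mem_columnGroup hz hq) (fun q _ q' _ h => ?_)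
    (fun g hg => ?_) fun _ _ => rfl).symm
  · refine Equiv.ext fun i => z.injective ?_
    rw [← Equiv.Perm.viaFintypeEmbedding_apply_image, h,
      Equiv.Perm.viaFintypeEmbedding_apply_image]
  · obtain ⟨q, hq, rfl⟩ := exists_via_eq hz hg
    exact ⟨q, hq, rfl⟩

/-- A permutation preserves all rows as soon as it does so on the core entries below the top
row. -/
theorem mem_rowGroup_iff_core (hz : IsCore μ z ρ κ) {g : Equiv.Perm (Fin n)} :
    g ∈ rowGroup μ ↔ ∀ i, ρ i ≠ 0 → rowOf μ (g (z i)) = ρ i := by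
  refine ⟨fun h i _ => (mem_rowGroup.1 h _).trans (hz.row i), fun h => ?_⟩
  have hlow : ∀ x, rowOf μ x ≠ 0 → rowOf μ (g x) = rowOf μ x := fun x hx => by
    by_cases hxz : x ∈ Set.range z
    · obtain ⟨i, rfl⟩ := hxz
      rw [hz.row] at hx ⊢
      exact h i hx
    · exact absurd (hz.row_compl x hxz) hx
  refine mem_rowGroup.2 fun x => ?_
  by_cases hx : rowOf μ x = 0
  · by_contra hne
    -- The set of entries below the top row is finite and mapped into itself, hence onto itself.
    set s := Finset.univ.filter fun x => rowOf μ x ≠ 0 with hs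
    have himg : s.image g = s := by
      refine Finset.eq_of_subset_of_card_le (fun y hy => ?_)
        (Finset.card_image_of_injective _ g.injective).ge
      obtain ⟨x, hx, rfl⟩ := Finset.mem_image.1 hy
      simp only [hs, Finset.mem_filter, Finset.mem_univ, true_and] at hx ⊢
      rwa [hlow x hx]
    have hgx : g x ∈ s.image g := by
      rw [himg]
      simpa [hs, hx] using hne
    obtain ⟨y, hy, hyx⟩ := Finset.mem_image.1 hgx
    rw [g.injective hyx] at hy
    simp [hs, hx] at hy
  · exact hlow x hx

theorem coeff_conj (hz : IsCore μ z ρ κ) (σ h : Equiv.Perm (Fin n)) :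
    (youngSymmetrizer μ).coeff (h⁻¹ * σ⁻¹ * h) = coreSum z ρ κ σ h := by
  have hinv : ∑ q ∈ columnGroup μ, (if h⁻¹ * σ⁻¹ * h * q⁻¹ ∈ rowGroup μ then
        ((Equiv.Perm.sign q : ℤ) : ℂ) else 0) =
      ∑ q ∈ columnGroup μ, (if h⁻¹ * σ⁻¹ * h * q ∈ rowGroup μ then
        ((Equiv.Perm.sign q : ℤ) : ℂ) else 0) :=
    Finset.sum_bij' (fun q _ => q⁻¹) (fun q _ => q⁻¹) (fun _ hq => inv_mem_columnGroup hq)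
      (fun _ hq => inv_mem_columnGroup hq) (fun _ _ => inv_inv _) (fun _ _ => inv_inv _)
      fun q _ => by rw [Equiv.Perm.sign_inv]
  rw [coeff_youngSymmetrizer, hinv, sum_columnGroup hz, coreSum]
  refine Finset.sum_congr rfl fun q _ => ?_
  have hprod : ∀ i, (∑ l with ρ l = ρ i, entry σ h (z i) (z (q l))) =
      if ∃ l, ρ l = ρ i ∧ σ (h (z i)) = h (z (q l)) then 1 else 0 := fun i => by
    split_ifs with hex
    · obtain ⟨l, hl, hl'⟩ := hex
      rw [Finset.sum_eq_single_of_mem l (by simpa using hl)]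
      · exact if_pos hl'
      · intro k _ hk
        refine if_neg fun hk' => ?_
        refine hk (q.injective (z.injective (h.injective ?_)))
        exact hk'.symm.trans hl'
    · refine Finset.sum_eq_zero fun l hl => if_neg fun hl' => hex ⟨l, by simpa using hl, hl'⟩
  simp_rw [hprod, Finset.prod_ite_zero]
  have hiff : h⁻¹ * σ⁻¹ * h * q.viaFintypeEmbedding z ∈ rowGroup μ ↔
      ∀ i ∈ Finset.univ.filter fun i => ρ i ≠ 0,
        ∃ l, ρ l = ρ i ∧ σ (h (z i)) = h (z (q l)) := by
    have hmem : h⁻¹ * σ⁻¹ * h * q.viaFintypeEmbedding z ∈ rowGroup μ ↔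
        (q.viaFintypeEmbedding z)⁻¹ * (h⁻¹ * σ * h) ∈ rowGroup μ := by
      constructor <;> intro hm <;> simpa [mul_assoc] using inv_mem_rowGroup hm
    rw [hmem, mem_rowGroup_iff_core hz]
    simp only [Finset.mem_filter, Finset.mem_univ, true_and]
    refine forall₂_congr fun i hi => ⟨fun hr => ?_, ?_⟩
    · have hx : ((q.viaFintypeEmbedding z)⁻¹ * (h⁻¹ * σ * h)) (z i) ∈ Set.range z := by
        by_contra hx
        exact hi (hr.symm.trans (hz.row_compl _ hx))
      obtain ⟨l, hl⟩ := hx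
      refine ⟨l, by rw [← hz.row, hl, hr], ?_⟩
      rw [← Equiv.Perm.viaFintypeEmbedding_apply_image, hl]
      simp
    · rintro ⟨l, hl, hl'⟩
      rw [← hl, ← hz.row l]
      congr 1
      rw [Equiv.Perm.mul_apply, Equiv.Perm.inv_eq_iff_eq,
        Equiv.Perm.viaFintypeEmbedding_apply_image, Equiv.Perm.mul_apply, Equiv.Perm.mul_apply,
        Equiv.Perm.inv_eq_iff_eq, hl']
  simp [hiff]

theorem irrChar_eq_of_core (hz : IsCore μ z ρ κ) {K : ℂ} {P : Equiv.Perm (Fin n) → ℂ}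
    (hF : ∀ σ, ∑ h : Equiv.Perm (Fin n), coreSum z ρ κ σ h = K * P σ)
    (hP : ∑ q ∈ coreColGroup κ,
      ((Equiv.Perm.sign q : ℤ) : ℂ) * P (q.viaFintypeEmbedding z) = (coreColGroup κ).card)
    (σ : Equiv.Perm (Fin n)) : irrChar μ σ = P σ := by
  refine irrChar_eq_of_sum_eq (K := K) (fun σ => ?_) ?_ σ
  · simp_rw [coeff_conj hz, hF]
  · rw [sum_columnGroup hz]
    simp_rw [Equiv.Perm.viaFintypeEmbedding_sign]
    rw [hP]
    have := sum_columnGroup hz fun _ => 1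
    simpa using this.symm

end Core

/-! ### Averages over a conjugacy class -/

section Average

variable {n : ℕ} (σ : Equiv.Perm (Fin n))

/-- The probability that a random conjugate of `σ` maps `x` to `y` for all pairs `(x, y)` in the
list `L`. -/
noncomputable def avg (L : List (Fin n × Fin n)) : ℂ :=
  (n.factorial : ℂ)⁻¹ * ∑ h : Equiv.Perm (Fin n), (L.map fun a => entry σ h a.1 a.2).prod

/-- The number of fixed points of `σ`. -/
def fixCount : ℕ := (Finset.univ.filter fun x => σ x = x).card

theorem entry_mul_of_ne_right (h : Equiv.Perm (Fin n)) {x y y' : Fin n} (hy : y ≠ y') :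
    entry σ h x y * entry σ h x y' = 0 := by
  unfold entry
  split_ifs with h1 h2 <;> simp
  exact hy (h.injective (h1.symm.trans h2))

theorem entry_mul_of_ne_left (h : Equiv.Perm (Fin n)) {x x' y : Fin n} (hx : x ≠ x') :
    entry σ h x y * entry σ h x' y = 0 := by
  unfold entry
  split_ifs with h1 h2 <;> simp
  exact hx (h.injective (σ.injective (h1.trans h2.symm)))

theorem entry_mul_self (h : Equiv.Perm (Fin n)) (x y : Fin n) :
    entry σ h x y * entry σ h x y = entry σ h x y := by
  unfold entry
  split_ifs <;> simp

theorem sum_entry (h : Equiv.Perm (Fin n)) (x : Fin n) : ∑ y, entry σ h x y = 1 := by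
  unfold entry
  rw [Finset.sum_eq_single_of_mem (h⁻¹ (σ (h x))) (Finset.mem_univ _)]
  · simp
  · intro y _ hy
    rw [if_neg]
    intro h'
    exact hy (by simp [h'])

theorem sum_entry_self (h : Equiv.Perm (Fin n)) : ∑ x, entry σ h x x = fixCount σ := by
  unfold entry
  rw [Equiv.sum_comp h fun x => if σ x = x then (1 : ℂ) else 0]
  simp [fixCount]

/-- Products of entries compose: the permutation matrix of a product. -/
theorem sum_entry_mul_entry (τ : Equiv.Perm (Fin n)) (h : Equiv.Perm (Fin n)) (x z : Fin n) :
    ∑ y, entry σ h x y * entry τ h y z = entry (τ * σ) h x z := by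
  rw [Finset.sum_eq_single_of_mem (h⁻¹ (σ (h x))) (Finset.mem_univ _)]
  · simp [entry]
    rfl
  · intro y _ hy
    have : entry σ h x y = 0 := if_neg fun h' => hy (by simp [h'])
    rw [this, zero_mul]

theorem avg_nil : avg σ [] = 1 := by
  simp [avg, Fintype.card_perm, Nat.factorial_ne_zero]

theorem avg_perm {L L' : List (Fin n × Fin n)} (h : L.Perm L') : avg σ L = avg σ L' := by
  unfold avg
  simp_rw [(h.map _).prod_eq]

theorem avg_swap (a b : Fin n × Fin n) (L : List (Fin n × Fin n)) :
    avg σ (a :: b :: L) = avg σ (b :: a :: L) := avg_perm σ (List.Perm.swap b a L)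

theorem avg_swap' (a b c : Fin n × Fin n) : avg σ [a, b, c] = avg σ [a, c, b] :=
  avg_perm σ (List.Perm.cons a (List.Perm.swap c b []))

/-- Averages only depend on the pattern of coincidences among the points. -/
theorem avg_map (τ : Equiv.Perm (Fin n)) (L : List (Fin n × Fin n)) :
    avg σ (L.map fun a => (τ a.1, τ a.2)) = avg σ L := by
  unfold avg
  congr 1
  conv_rhs => rw [← Equiv.sum_comp (Equiv.mulRight τ)]
  simp [entry, Function.comp_def]
  rfl

/-- Two pairs with the same source and different targets, or with the same target and different
sources, exclude each other. -/
theorem avg_cons_cons_eq_zero {a b : Fin n × Fin n} {L : List (Fin n × Fin n)}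
    (h : a.1 = b.1 ∧ a.2 ≠ b.2 ∨ a.1 ≠ b.1 ∧ a.2 = b.2) : avg σ (a :: b :: L) = 0 := by
  obtain ⟨x, y⟩ := a
  obtain ⟨x', y'⟩ := b
  simp only at h
  rcases h with ⟨rfl, h⟩ | ⟨h, rfl⟩
  · simp [avg, ← mul_assoc, entry_mul_of_ne_right σ _ h]
  · simp [avg, ← mul_assoc, entry_mul_of_ne_left σ _ h]

theorem avg_cons_cons_cons_eq_zero {a b c : Fin n × Fin n} {L : List (Fin n × Fin n)}
    (h : a.1 = c.1 ∧ a.2 ≠ c.2 ∨ a.1 ≠ c.1 ∧ a.2 = c.2) : avg σ (a :: b :: c :: L) = 0 := by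
  rw [avg_perm σ ((List.Perm.swap c b L).cons a), avg_cons_cons_eq_zero σ h]

theorem avg_cons_cons_self (a : Fin n × Fin n) (L : List (Fin n × Fin n)) :
    avg σ (a :: a :: L) = avg σ (a :: L) := by
  simp [avg, ← mul_assoc, entry_mul_self]

theorem avg_cons_cons_cons_self (a b : Fin n × Fin n) (L : List (Fin n × Fin n)) :
    avg σ (a :: b :: a :: L) = avg σ (a :: b :: L) := by
  rw [avg_perm σ ((List.Perm.swap a b L).cons a), avg_cons_cons_self]

theorem sum_avg_cons (x : Fin n) (L : List (Fin n × Fin n)) :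
    ∑ y, avg σ ((x, y) :: L) = avg σ L := by
  simp_rw [avg, ← Finset.mul_sum, List.map_cons, List.prod_cons]
  rw [Finset.sum_comm]
  simp_rw [← Finset.sum_mul, sum_entry, one_mul]

theorem sum_avg_cons_self (L : List (Fin n × Fin n)) :
    ∑ x, avg σ ((x, x) :: L) = fixCount σ * avg σ L := by
  simp_rw [avg, ← Finset.mul_sum, List.map_cons, List.prod_cons]
  rw [Finset.sum_comm]
  simp_rw [← Finset.sum_mul, sum_entry_self, ← Finset.mul_sum]
  ring

/-- A sum of averages in which all points outside of `S` play the same role. -/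
theorem sum_eq_of_forall_notMem {S : Finset (Fin n)} {w : Fin n} {f : Fin n → ℂ}
    (hf : ∀ v, v ∉ S → f v = f w) : ∑ v, f v = ∑ v ∈ S, f v + ((n : ℂ) - S.card) * f w := by
  rw [← Finset.sum_add_sum_compl S, Finset.sum_congr rfl fun v hv => hf v (Finset.mem_compl.1 hv),
    Finset.sum_const, Finset.card_compl, Fintype.card_fin, nsmul_eq_mul,
    Nat.cast_sub (by simpa using Finset.card_le_univ S)]

theorem sub_card_ne_zero {S : Finset (Fin n)} {w : Fin n} (hw : w ∉ S) :
    (n : ℂ) - S.card ≠ 0 := by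
  have h : S.card < n := by
    have := Finset.card_lt_univ_of_notMem hw
    rwa [Fintype.card_fin] at this
  exact sub_ne_zero.2 (Nat.cast_injective.ne h.ne')

theorem map_swap_eq_self {S : Finset (Fin n)} {v w : Fin n} (hv : v ∉ S) (hw : w ∉ S)
    {L : List (Fin n × Fin n)} (hL : ∀ a ∈ L, a.1 ∈ S ∧ a.2 ∈ S) :
    (L.map fun a => (Equiv.swap v w a.1, Equiv.swap v w a.2)) = L := by
  have hS : ∀ x ∈ S, Equiv.swap v w x = x := fun x hx =>
    Equiv.swap_apply_of_ne_of_ne (fun h => hv (h ▸ hx)) fun h => hw (h ▸ hx)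
  conv_rhs => rw [← List.map_id L]
  refine List.map_congr_left fun a ha => ?_
  simp [hS _ (hL a ha).1, hS _ (hL a ha).2]

/-- The probability of `L` and of one more pair `(x, w)` whose target `w` is new. -/
theorem avg_cons_new {S : Finset (Fin n)} {x w : Fin n} {L : List (Fin n × Fin n)}
    (hL : ∀ a ∈ L, a.1 ∈ S ∧ a.2 ∈ S) (hx : x ∈ S) (hw : w ∉ S) :
    avg σ ((x, w) :: L) = (avg σ L - ∑ u ∈ S, avg σ ((x, u) :: L)) / ((n : ℂ) - S.card) := by
  rw [eq_div_iff (sub_card_ne_zero hw), ← sum_avg_cons σ x L,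
    sum_eq_of_forall_notMem (S := S) (w := w)]
  · ring
  · intro v hv
    rw [← avg_map σ (Equiv.swap v w), List.map_cons, map_swap_eq_self hv hw hL,
      Equiv.swap_apply_left,
      Equiv.swap_apply_of_ne_of_ne (ne_of_mem_of_not_mem hx hv) (ne_of_mem_of_not_mem hx hw)]

/-- The probability of `L` and of one more pair `(w, w)` with a new point `w`. -/
theorem avg_cons_new_self {S : Finset (Fin n)} {w : Fin n} {L : List (Fin n × Fin n)}
    (hL : ∀ a ∈ L, a.1 ∈ S ∧ a.2 ∈ S) (hw : w ∉ S) :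
    avg σ ((w, w) :: L) =
      (fixCount σ * avg σ L - ∑ u ∈ S, avg σ ((u, u) :: L)) / ((n : ℂ) - S.card) := by
  rw [eq_div_iff (sub_card_ne_zero hw), ← sum_avg_cons_self σ L,
    sum_eq_of_forall_notMem (S := S) (w := w)]
  · ring
  · intro v hv
    rw [← avg_map σ (Equiv.swap v w), List.map_cons, map_swap_eq_self hv hw hL,
      Equiv.swap_apply_left]

theorem avg_mul_fix (τ : Equiv.Perm (Fin n)) (x : Fin n) :
    avg (σ * τ) [(x, x)] = ∑ y, (n.factorial : ℂ)⁻¹ *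
      ∑ h : Equiv.Perm (Fin n), entry τ h x y * entry σ h y x := by
  rw [← Finset.mul_sum, Finset.sum_comm]
  simp_rw [sum_entry_mul_entry]
  simp [avg]

theorem avg_sq_fix (x : Fin n) : avg (σ * σ) [(x, x)] = ∑ y, avg σ [(x, y), (y, x)] := by
  rw [avg_mul_fix]
  simp [avg]

theorem avg_cube_fix (x : Fin n) :
    avg (σ * σ * σ) [(x, x)] = ∑ y, ∑ z, avg σ [(x, y), (y, z), (z, x)] := by
  rw [avg_mul_fix]
  simp_rw [← sum_entry_mul_entry σ σ, Finset.mul_sum]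
  refine Finset.sum_congr rfl fun y _ => ?_
  rw [Finset.sum_comm]
  simp [avg, Finset.mul_sum]

end Average

/-! ### Probabilities of the partial maps on at most three points -/

/- The names list the connected components of the partial map: `fix` is a fixed point `x ↦ x`, `out`
an arrow `x ↦ w` with a separate target, `path` a path `x ↦ y ↦ w`, `path_path` a path with three
arrows. Each value follows from values with fewer distinct points, by summing over the target of the
last arrow (`avg_cons_new`) or over the position of a fixed point (`avg_cons_new_self`). -/

section Values

variable {n : ℕ} (σ : Equiv.Perm (Fin n))

/-- The number of points on cycles of length two, as a complex number. -/
noncomputable def pts2 : ℂ := fixCount (σ * σ) - fixCount σ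

/-- The number of points on cycles of length three, as a complex number. -/
noncomputable def pts3 : ℂ := fixCount (σ * σ * σ) - fixCount σ

theorem cast_sub_ne_zero {k : ℕ} (h : k < n) : (n : ℂ) - k ≠ 0 :=
  sub_ne_zero.2 (Nat.cast_injective.ne h.ne')

theorem avg_fix (x : Fin n) : avg σ [(x, x)] = fixCount σ / n := by
  rw [avg_cons_new_self σ (S := ∅) (by simp) (by simp), avg_nil]
  simp

theorem avg_out (hn : 2 ≤ n) {x w : Fin n} (hw : w ∉ ({x} : Finset (Fin n))) :
    avg σ [(x, w)] = (n - fixCount σ) / (n * (n - 1)) := by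
  have h0 := cast_sub_ne_zero (n := n) (k := 0) (by omega)
  have h1 := cast_sub_ne_zero (n := n) (k := 1) (by omega)
  rw [avg_cons_new σ (S := {x}) (by simp) (by simp) hw, avg_nil]
  simp only [Finset.sum_singleton, avg_fix, Finset.card_singleton]
  push_cast [sub_zero] at *
  field_simp

theorem avg_fix_fix (hn : 2 ≤ n) {x y : Fin n} (h : [x, y].Nodup) :
    avg σ [(x, x), (y, y)] = fixCount σ * (fixCount σ - 1) / (n * (n - 1)) := by
  have h0 := cast_sub_ne_zero (n := n) (k := 0) (by omega)
  have h1 := cast_sub_ne_zero (n := n) (k := 1) (by omega)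
  simp at h
  rw [avg_cons_new_self σ (S := {y}) (by simp) (by simp [h])]
  simp only [Finset.sum_singleton, avg_cons_cons_self, avg_fix, Finset.card_singleton]
  push_cast [sub_zero] at *
  field_simp

theorem avg_two_cycle (hn : 2 ≤ n) {x y : Fin n} (h : [x, y].Nodup) :
    avg σ [(x, y), (y, x)] = pts2 σ / (n * (n - 1)) := by
  have h0 := cast_sub_ne_zero (n := n) (k := 0) (by omega)
  have h1 := cast_sub_ne_zero (n := n) (k := 1) (by omega)
  simp at h
  have hsum := avg_sq_fix σ x
  rw [sum_eq_of_forall_notMem (S := {x}) (w := y), Finset.sum_singleton,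
    avg_cons_cons_self, avg_fix, avg_fix] at hsum
  · rw [pts2]
    simp only [Finset.card_singleton] at hsum
    push_cast [sub_zero] at *
    field_simp at hsum ⊢
    linear_combination -hsum
  · intro v hv
    rw [← avg_map σ (Equiv.swap v y)]
    simp at hv
    simp [Equiv.swap_apply_of_ne_of_ne (Ne.symm hv) h]

theorem avg_fix_out (hn : 3 ≤ n) {x y w : Fin n} (h : [x, y, w].Nodup) :
    avg σ [(x, x), (y, w)] = fixCount σ * (n - fixCount σ) / (n * (n - 1) * (n - 2)) := by
  have h0 := cast_sub_ne_zero (n := n) (k := 0) (by omega)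
  have h1 := cast_sub_ne_zero (n := n) (k := 1) (by omega)
  have h2 := cast_sub_ne_zero (n := n) (k := 2) (by omega)
  simp at h
  rw [avg_swap, avg_cons_new σ (S := {x, y}) (by simp) (by simp) (by grind),
    Finset.sum_pair (by grind),
    avg_cons_cons_eq_zero σ (a := (y, x)) (b := (x, x)) (by grind),
    avg_fix_fix σ (by omega) (by grind), avg_fix, Finset.card_pair (by grind)]
  push_cast [sub_zero] at *
  field_simp
  ring

theorem avg_path (hn : 3 ≤ n) {x y w : Fin n} (h : [x, y, w].Nodup) :
    avg σ [(x, y), (y, w)] = (n - fixCount σ - pts2 σ) / (n * (n - 1) * (n - 2)) := by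
  have h0 := cast_sub_ne_zero (n := n) (k := 0) (by omega)
  have h1 := cast_sub_ne_zero (n := n) (k := 1) (by omega)
  have h2 := cast_sub_ne_zero (n := n) (k := 2) (by omega)
  simp at h
  rw [avg_swap, avg_cons_new σ (S := {x, y}) (by simp) (by simp) (by grind),
    Finset.sum_pair (by grind),
    avg_cons_cons_eq_zero σ (a := (y, y)) (b := (x, y)) (by grind),
    avg_two_cycle σ (by omega) (by grind), avg_out σ (by omega) (by grind),
    Finset.card_pair (by grind)]
  push_cast [sub_zero] at *
  field_simp
  ring

theorem avg_out_out (hn : 4 ≤ n) {x y w v : Fin n} (h : [x, y, w, v].Nodup) :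
    avg σ [(x, w), (y, v)] =
      ((n - fixCount σ) * (n - 3 - fixCount σ) + pts2 σ) /
        (n * (n - 1) * (n - 2) * (n - 3)) := by
  have h0 := cast_sub_ne_zero (n := n) (k := 0) (by omega)
  have h1 := cast_sub_ne_zero (n := n) (k := 1) (by omega)
  have h2 := cast_sub_ne_zero (n := n) (k := 2) (by omega)
  have h3 := cast_sub_ne_zero (n := n) (k := 3) (by omega)
  simp at h
  rw [avg_swap, avg_cons_new σ (S := {x, y, w}) (by simp) (by simp) (by grind),
    Finset.sum_insert (by grind), Finset.sum_pair (by grind),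
    avg_cons_cons_eq_zero σ (a := (y, w)) (b := (x, w)) (by grind),
    avg_path σ (by omega) (by grind), avg_fix_out σ (by omega) (by grind),
    avg_out σ (by omega) (by grind), Finset.card_insert_of_notMem (by grind),
    Finset.card_pair (by grind)]
  push_cast [sub_zero] at *
  field_simp
  ring

theorem avg_fix_fix_fix (hn : 3 ≤ n) {x y z : Fin n} (h : [x, y, z].Nodup) :
    avg σ [(x, x), (y, y), (z, z)] =
      fixCount σ * (fixCount σ - 1) * (fixCount σ - 2) / (n * (n - 1) * (n - 2)) := by
  have h0 := cast_sub_ne_zero (n := n) (k := 0) (by omega)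
  have h1 := cast_sub_ne_zero (n := n) (k := 1) (by omega)
  have h2 := cast_sub_ne_zero (n := n) (k := 2) (by omega)
  simp at h
  rw [avg_cons_new_self σ (S := {y, z}) (by simp) (by grind), Finset.sum_pair (by grind),
    avg_cons_cons_self, avg_cons_cons_cons_self,
    avg_swap σ (z, z), avg_fix_fix σ (by omega) (by grind), Finset.card_pair (by grind)]
  push_cast [sub_zero] at *
  field_simp
  ring

theorem avg_fix_two_cycle (hn : 3 ≤ n) {x y z : Fin n} (h : [x, y, z].Nodup) :
    avg σ [(x, x), (y, z), (z, y)] = fixCount σ * pts2 σ / (n * (n - 1) * (n - 2)) := by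
  have h0 := cast_sub_ne_zero (n := n) (k := 0) (by omega)
  have h1 := cast_sub_ne_zero (n := n) (k := 1) (by omega)
  have h2 := cast_sub_ne_zero (n := n) (k := 2) (by omega)
  simp at h
  rw [avg_cons_new_self σ (S := {y, z}) (by simp) (by grind), Finset.sum_pair (by grind),
    avg_cons_cons_eq_zero σ (a := (y, y)) (b := (y, z)) (by grind),
    avg_cons_cons_cons_eq_zero σ (a := (z, z)) (c := (z, y)) (by grind),
    avg_two_cycle σ (by omega) (by grind), Finset.card_pair (by grind)]
  push_cast [sub_zero] at *
  field_simp
  ring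

theorem avg_three_cycle (hn : 3 ≤ n) {x y z : Fin n} (h : [x, y, z].Nodup) :
    avg σ [(x, y), (y, z), (z, x)] = pts3 σ / (n * (n - 1) * (n - 2)) := by
  have h0 := cast_sub_ne_zero (n := n) (k := 0) (by omega)
  have h1 := cast_sub_ne_zero (n := n) (k := 1) (by omega)
  have h2 := cast_sub_ne_zero (n := n) (k := 2) (by omega)
  simp at h
  have hsum := avg_cube_fix σ x
  rw [sum_eq_of_forall_notMem (S := {x}) (w := y), Finset.sum_singleton,
    Finset.sum_eq_single_of_mem x (Finset.mem_univ _) fun z _ hz =>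
      avg_cons_cons_eq_zero σ (a := (x, x)) (b := (x, z)) (by grind),
    avg_cons_cons_self, avg_cons_cons_self,
    sum_eq_of_forall_notMem (S := {x, y}) (w := z), Finset.sum_pair (by grind),
    avg_cons_cons_cons_eq_zero σ (a := (x, y)) (c := (x, x)) (by grind),
    avg_cons_cons_eq_zero σ (a := (x, y)) (b := (y, y)) (by grind),
    avg_fix, avg_fix, Finset.card_pair (by grind)] at hsum
  · rw [pts3]
    simp only [Finset.card_singleton] at hsum
    push_cast [sub_zero] at *
    field_simp at hsum ⊢
    linear_combination -hsum
  · intro v hv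
    rw [← avg_map σ (Equiv.swap v z)]
    have hx := Equiv.swap_apply_of_ne_of_ne (a := v) (b := z) (x := x) (by grind) (by grind)
    have hy := Equiv.swap_apply_of_ne_of_ne (a := v) (b := z) (x := y) (by grind) (by grind)
    simp [hx, hy]
  · intro v hv
    rw [← Equiv.sum_comp (Equiv.swap v y)]
    refine Finset.sum_congr rfl fun u _ => ?_
    rw [← avg_map σ (Equiv.swap v y)]
    have hx := Equiv.swap_apply_of_ne_of_ne (a := v) (b := y) (x := x) (by grind) (by grind)
    simp [hx]

theorem avg_fix_fix_out (hn : 4 ≤ n) {x y z w : Fin n} (h : [x, y, z, w].Nodup) :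
    avg σ [(x, x), (y, y), (z, w)] = fixCount σ * (fixCount σ - 1) * (n - fixCount σ) /
      (n * (n - 1) * (n - 2) * (n - 3)) := by
  have h0 := cast_sub_ne_zero (n := n) (k := 0) (by omega)
  have h1 := cast_sub_ne_zero (n := n) (k := 1) (by omega)
  have h2 := cast_sub_ne_zero (n := n) (k := 2) (by omega)
  have h3 := cast_sub_ne_zero (n := n) (k := 3) (by omega)
  simp at h
  rw [avg_swap', avg_swap, avg_cons_new σ (S := {x, y, z}) (by simp) (by simp) (by grind),
    Finset.sum_insert (by grind), Finset.sum_pair (by grind),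
    avg_cons_cons_eq_zero σ (a := (z, x)) (b := (x, x)) (by grind),
    avg_cons_cons_cons_eq_zero σ (a := (z, y)) (c := (y, y)) (by grind),
    avg_fix_fix_fix σ (by omega) (by grind), avg_fix_fix σ (by omega) (by grind),
    Finset.card_insert_of_notMem (by grind), Finset.card_pair (by grind)]
  push_cast [sub_zero] at *
  field_simp
  ring

theorem avg_two_cycle_out (hn : 4 ≤ n) {x y z w : Fin n} (h : [x, y, z, w].Nodup) :
    avg σ [(x, y), (y, x), (z, w)] = pts2 σ * (n - 2 - fixCount σ) /
      (n * (n - 1) * (n - 2) * (n - 3)) := by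
  have h0 := cast_sub_ne_zero (n := n) (k := 0) (by omega)
  have h1 := cast_sub_ne_zero (n := n) (k := 1) (by omega)
  have h2 := cast_sub_ne_zero (n := n) (k := 2) (by omega)
  have h3 := cast_sub_ne_zero (n := n) (k := 3) (by omega)
  simp at h
  rw [avg_swap', avg_swap, avg_cons_new σ (S := {x, y, z}) (by simp) (by simp) (by grind),
    Finset.sum_insert (by grind), Finset.sum_pair (by grind),
    avg_cons_cons_cons_eq_zero σ (a := (z, x)) (c := (y, x)) (by grind),
    avg_cons_cons_eq_zero σ (a := (z, y)) (b := (x, y)) (by grind),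
    avg_fix_two_cycle σ (by omega) (by grind), avg_two_cycle σ (by omega) (by grind),
    Finset.card_insert_of_notMem (by grind), Finset.card_pair (by grind)]
  push_cast [sub_zero] at *
  field_simp
  ring

theorem avg_fix_path (hn : 4 ≤ n) {x y z w : Fin n} (h : [x, y, z, w].Nodup) :
    avg σ [(x, x), (y, z), (z, w)] = fixCount σ * (n - fixCount σ - pts2 σ) /
      (n * (n - 1) * (n - 2) * (n - 3)) := by
  have h0 := cast_sub_ne_zero (n := n) (k := 0) (by omega)
  have h1 := cast_sub_ne_zero (n := n) (k := 1) (by omega)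
  have h2 := cast_sub_ne_zero (n := n) (k := 2) (by omega)
  have h3 := cast_sub_ne_zero (n := n) (k := 3) (by omega)
  simp at h
  rw [avg_cons_new_self σ (S := {y, z, w}) (by simp) (by grind),
    Finset.sum_insert (by grind), Finset.sum_pair (by grind),
    avg_cons_cons_eq_zero σ (a := (y, y)) (b := (y, z)) (by grind),
    avg_cons_cons_cons_eq_zero σ (a := (z, z)) (c := (z, w)) (by grind),
    avg_cons_cons_cons_eq_zero σ (a := (w, w)) (c := (z, w)) (by grind),
    avg_path σ (by omega) (by grind),
    Finset.card_insert_of_notMem (by grind), Finset.card_pair (by grind)]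
  push_cast [sub_zero] at *
  field_simp
  ring

theorem avg_path_path (hn : 4 ≤ n) {x y z w : Fin n} (h : [x, y, z, w].Nodup) :
    avg σ [(x, y), (y, z), (z, w)] = (n - fixCount σ - pts2 σ - pts3 σ) /
      (n * (n - 1) * (n - 2) * (n - 3)) := by
  have h0 := cast_sub_ne_zero (n := n) (k := 0) (by omega)
  have h1 := cast_sub_ne_zero (n := n) (k := 1) (by omega)
  have h2 := cast_sub_ne_zero (n := n) (k := 2) (by omega)
  have h3 := cast_sub_ne_zero (n := n) (k := 3) (by omega)
  simp at h
  rw [avg_swap', avg_swap, avg_cons_new σ (S := {x, y, z}) (by simp) (by simp) (by grind),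
    Finset.sum_insert (by grind), Finset.sum_pair (by grind),
    avg_cons_cons_eq_zero σ (a := (z, y)) (b := (x, y)) (by grind),
    avg_cons_cons_cons_eq_zero σ (a := (z, z)) (c := (y, z)) (by grind),
    avg_three_cycle σ (by omega) (by grind), avg_path σ (by omega) (by grind),
    Finset.card_insert_of_notMem (by grind), Finset.card_pair (by grind)]
  push_cast [sub_zero] at *
  field_simp
  ring

theorem avg_fix_out_out (hn : 5 ≤ n) {x y z w v : Fin n} (h : [x, y, z, w, v].Nodup) :
    avg σ [(x, x), (y, w), (z, v)] =
      fixCount σ * ((n - fixCount σ) * (n - 3 - fixCount σ) + pts2 σ) /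
        (n * (n - 1) * (n - 2) * (n - 3) * (n - 4)) := by
  have h0 := cast_sub_ne_zero (n := n) (k := 0) (by omega)
  have h1 := cast_sub_ne_zero (n := n) (k := 1) (by omega)
  have h2 := cast_sub_ne_zero (n := n) (k := 2) (by omega)
  have h3 := cast_sub_ne_zero (n := n) (k := 3) (by omega)
  have h4 := cast_sub_ne_zero (n := n) (k := 4) (by omega)
  simp at h
  rw [avg_cons_new_self σ (S := {y, z, w, v}) (by simp) (by grind),
    Finset.sum_insert (by grind), Finset.sum_insert (by grind), Finset.sum_pair (by grind),
    avg_cons_cons_eq_zero σ (a := (y, y)) (b := (y, w)) (by grind),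
    avg_cons_cons_cons_eq_zero σ (a := (z, z)) (c := (z, v)) (by grind),
    avg_cons_cons_eq_zero σ (a := (w, w)) (b := (y, w)) (by grind),
    avg_cons_cons_cons_eq_zero σ (a := (v, v)) (c := (z, v)) (by grind),
    avg_out_out σ (by omega) (by grind), Finset.card_insert_of_notMem (by grind),
    Finset.card_insert_of_notMem (by grind), Finset.card_pair (by grind)]
  push_cast [sub_zero] at *
  field_simp
  ring

theorem avg_path_out (hn : 5 ≤ n) {x y z w v : Fin n} (h : [x, y, z, w, v].Nodup) :
    avg σ [(x, y), (y, w), (z, v)] =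
      ((n - fixCount σ - pts2 σ) * (n - 4 - fixCount σ) + pts3 σ) /
        (n * (n - 1) * (n - 2) * (n - 3) * (n - 4)) := by
  have h0 := cast_sub_ne_zero (n := n) (k := 0) (by omega)
  have h1 := cast_sub_ne_zero (n := n) (k := 1) (by omega)
  have h2 := cast_sub_ne_zero (n := n) (k := 2) (by omega)
  have h3 := cast_sub_ne_zero (n := n) (k := 3) (by omega)
  have h4 := cast_sub_ne_zero (n := n) (k := 4) (by omega)
  simp at h
  rw [avg_swap', avg_swap, avg_cons_new σ (S := {x, y, z, w}) (by simp) (by simp) (by grind),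
    Finset.sum_insert (by grind), Finset.sum_insert (by grind), Finset.sum_pair (by grind),
    avg_cons_cons_eq_zero σ (a := (z, y)) (b := (x, y)) (by grind),
    avg_cons_cons_cons_eq_zero σ (a := (z, w)) (c := (y, w)) (by grind),
    avg_path_path σ (by omega) (by grind), avg_fix_path σ (by omega) (by grind),
    avg_path σ (by omega) (by grind), Finset.card_insert_of_notMem (by grind),
    Finset.card_insert_of_notMem (by grind), Finset.card_pair (by grind)]
  push_cast [sub_zero] at *
  field_simp
  ring

theorem avg_out_out_out (hn : 6 ≤ n) {x y z w v u : Fin n} (h : [x, y, z, w, v, u].Nodup) :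
    avg σ [(x, w), (y, v), (z, u)] =
      ((n - 4 - fixCount σ) * ((n - fixCount σ) * (n - 3 - fixCount σ) + pts2 σ)
        - 2 * ((n - fixCount σ - pts2 σ) * (n - 4 - fixCount σ) + pts3 σ)) /
        (n * (n - 1) * (n - 2) * (n - 3) * (n - 4) * (n - 5)) := by
  have h0 := cast_sub_ne_zero (n := n) (k := 0) (by omega)
  have h1 := cast_sub_ne_zero (n := n) (k := 1) (by omega)
  have h2 := cast_sub_ne_zero (n := n) (k := 2) (by omega)
  have h3 := cast_sub_ne_zero (n := n) (k := 3) (by omega)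
  have h4 := cast_sub_ne_zero (n := n) (k := 4) (by omega)
  have h5 := cast_sub_ne_zero (n := n) (k := 5) (by omega)
  simp at h
  rw [avg_swap', avg_swap, avg_cons_new σ (S := {x, y, z, w, v}) (by simp) (by simp) (by grind),
    Finset.sum_insert (by grind), Finset.sum_insert (by grind), Finset.sum_insert (by grind),
    Finset.sum_pair (by grind),
    avg_cons_cons_eq_zero σ (a := (z, w)) (b := (x, w)) (by grind),
    avg_cons_cons_cons_eq_zero σ (a := (z, v)) (c := (y, v)) (by grind),
    avg_path_out σ (by omega) (by grind), avg_swap' σ (z, y), avg_path_out σ (by omega) (by grind),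
    avg_fix_out_out σ (by omega) (by grind), avg_out_out σ (by omega) (by grind),
    Finset.card_insert_of_notMem (by grind), Finset.card_insert_of_notMem (by grind),
    Finset.card_insert_of_notMem (by grind), Finset.card_pair (by grind)]
  push_cast [sub_zero] at *
  field_simp
  ring

end Values

/-! ### Evaluation of the criterion -/

section Order

variable {n : ℕ} (σ : Equiv.Perm (Fin n))

/- The following rules sort a list of at most three pairs: fixed points come first, and pairs that
form a path or a cycle follow each other. Their hypotheses make them terminate. An append on the
right-hand side keeps `simp` from applying them only in the direction of its term order. -/

theorem avg_order_fix {x y z : Fin n} {L : List (Fin n × Fin n)} (_h : x ≠ y) :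
    avg σ ((x, y) :: (z, z) :: L) = avg σ ([(z, z)] ++ (x, y) :: L) := avg_swap σ _ _ _

theorem avg_order_fix' {x y z : Fin n} {a : Fin n × Fin n} (_h : x ≠ y) :
    avg σ [a, (x, y), (z, z)] = avg σ ([a] ++ [(z, z), (x, y)]) := avg_swap' σ _ _ _

theorem avg_order_path {x y z : Fin n} {L : List (Fin n × Fin n)} (_h : z ≠ x) :
    avg σ ((y, z) :: (x, y) :: L) = avg σ ([(x, y)] ++ (y, z) :: L) := avg_swap σ _ _ _

theorem avg_order_path' {x y z : Fin n} {a : Fin n × Fin n} (_h : z ≠ x) :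
    avg σ [a, (y, z), (x, y)] = avg σ ([a] ++ [(x, y), (y, z)]) := avg_swap' σ _ _ _

theorem avg_order_path_path {x y z w : Fin n} (_h : w ≠ x) :
    avg σ [(y, z), (z, w), (x, y)] = avg σ ([(x, y)] ++ [(y, z), (z, w)]) := by
  rw [avg_swap', avg_swap, List.singleton_append]

theorem avg_order_path_out {x y z w v : Fin n} (_h : z ≠ v) :
    avg σ [(x, y), (z, v), (y, w)] = avg σ ([(x, y)] ++ [(y, w), (z, v)]) := avg_swap' σ _ _ _

theorem avg_order_path_out' {x y z w v : Fin n} (_h : z ≠ v) (_h' : w ≠ z) :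
    avg σ [(y, w), (z, v), (x, y)] = avg σ ([(x, y)] ++ [(y, w), (z, v)]) := by
  rw [avg_swap', avg_swap, List.singleton_append]

theorem avg_order_out_path {x y z w v : Fin n} (_h : z ≠ v) (_h' : v ≠ x) :
    avg σ [(z, v), (x, y), (y, w)] = avg σ ([(x, y)] ++ [(y, w), (z, v)]) := by
  rw [avg_swap, avg_swap', List.singleton_append]

theorem avg_eq_zero₁₂ {x x' y : Fin n} {L : List (Fin n × Fin n)} (h : x ≠ x') :
    avg σ ((x, y) :: (x', y) :: L) = 0 := avg_cons_cons_eq_zero σ (Or.inr ⟨h, rfl⟩)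

theorem avg_eq_zero₁₃ {x x' y : Fin n} {a : Fin n × Fin n} {L : List (Fin n × Fin n)}
    (h : x ≠ x') : avg σ ((x, y) :: a :: (x', y) :: L) = 0 :=
  avg_cons_cons_cons_eq_zero σ (Or.inr ⟨h, rfl⟩)

theorem avg_eq_zero₂₃ {x x' y : Fin n} {a : Fin n × Fin n} (h : x ≠ x') :
    avg σ [a, (x, y), (x', y)] = 0 := by
  rw [avg_swap, avg_eq_zero₁₃ σ h]

theorem sum_entry_one (x x' : Fin n) :
    ∑ h : Equiv.Perm (Fin n), entry σ h x x' = n.factorial * avg σ [(x, x')] := by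
  rw [avg, mul_inv_cancel_left₀ (by exact_mod_cast n.factorial_ne_zero)]
  simp

theorem sum_entry_two (x x' y y' : Fin n) :
    ∑ h : Equiv.Perm (Fin n), entry σ h x x' * entry σ h y y' =
      n.factorial * avg σ [(x, x'), (y, y')] := by
  rw [avg, mul_inv_cancel_left₀ (by exact_mod_cast n.factorial_ne_zero)]
  simp

theorem sum_entry_three (x x' y y' z z' : Fin n) :
    ∑ h : Equiv.Perm (Fin n), entry σ h x x' * entry σ h y y' * entry σ h z z' =
      n.factorial * avg σ [(x, x'), (y, y'), (z, z')] := by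
  rw [avg, mul_inv_cancel_left₀ (by exact_mod_cast n.factorial_ne_zero)]
  simp [mul_assoc]

end Order

section Criterion

variable {n m : ℕ} {μ : n.Partition} {z : Fin m ↪ Fin n} {ρ κ : Fin m → ℕ}

/-- A sum over a finite set, evaluated from a list of the values of `g`. -/
theorem sum_eq_list_sum {α β : Type*} {s : Finset β} {g : β → α} {L : List α}
    (hL : s.val.map g = ↑L) (F : α → ℂ) : ∑ q ∈ s, F (g q) = (L.map F).sum := by
  rw [← Multiset.sum_coe, ← Multiset.map_coe, ← hL, Multiset.map_map]
  rfl

theorem fixCount_via (q : Equiv.Perm (Fin m)) :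
    (fixCount (q.viaFintypeEmbedding z) : ℂ) = n - m + fixCount q := by
  have h : fixCount (q.viaFintypeEmbedding z) + m = n + fixCount q := by
    have h1 : (Finset.univ.filter fun x => q.viaFintypeEmbedding z x = x) =
        (Finset.univ.filter fun i => q i = i).map z ∪ (Finset.univ.map z)ᶜ := by
      ext x
      by_cases hx : x ∈ Set.range z
      · obtain ⟨i, rfl⟩ := hx
        simp [Equiv.Perm.viaFintypeEmbedding_apply_image]
      · have hx' : ∀ i, z i ≠ x := fun i hi => hx ⟨i, hi⟩
        simp [Equiv.Perm.viaFintypeEmbedding_apply_notMem_range _ _ hx, hx']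
    have h2 : m ≤ n := by simpa using Fintype.card_le_of_embedding z
    rw [fixCount, h1, Finset.card_union_of_disjoint, Finset.card_map, Finset.card_compl,
      Finset.card_map, Finset.card_univ, Fintype.card_fin, Fintype.card_fin, fixCount]
    · omega
    · rw [Finset.disjoint_left]
      intro x hx hx'
      obtain ⟨i, -, rfl⟩ := Finset.mem_map.1 hx
      simp at hx'
  linear_combination (by exact_mod_cast h :
    (fixCount (q.viaFintypeEmbedding z) : ℂ) + m = n + fixCount q)

theorem via_mul (q q' : Equiv.Perm (Fin m)) :
    q.viaFintypeEmbedding z * q'.viaFintypeEmbedding z = (q * q').viaFintypeEmbedding z :=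
  Equiv.Perm.extendDomain_mul _ _ _

/-- The criterion for a character that is a function `Q` of the numbers of points on cycles of
lengths one, two and three. -/
theorem irrChar_eq_of_core' (hz : IsCore μ z ρ κ) {K : ℂ} {Q : ℂ → ℂ → ℂ → ℂ}
    (hF : ∀ σ, ∑ h : Equiv.Perm (Fin n), coreSum z ρ κ σ h =
      K * Q (fixCount σ) (pts2 σ) (pts3 σ))
    (hQ : ∑ q ∈ coreColGroup κ, ((Equiv.Perm.sign q : ℤ) : ℂ) *
      Q (n - m + fixCount q) (fixCount (q * q) - fixCount q)
        (fixCount (q * q * q) - fixCount q) = (coreColGroup κ).card)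
    (σ : Equiv.Perm (Fin n)) : irrChar μ σ = Q (fixCount σ) (pts2 σ) (pts3 σ) := by
  refine irrChar_eq_of_core hz (P := fun σ => Q (fixCount σ) (pts2 σ) (pts3 σ)) hF ?_ σ
  rw [← hQ]
  refine Finset.sum_congr rfl fun q _ => ?_
  simp only [pts2, pts3, via_mul, fixCount_via, add_sub_add_left_eq_sub]

theorem mem_diagram_toPartition {rows : List ℕ} (h : IsPartitionOf rows n) (a : ℕ × ℕ) :
    a ∈ (diagram (toPartition h)).cells ↔ ∃ h : a.1 < rows.length, a.2 < rows[a.1] := by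
  have hsort : (toPartition h).parts.sort (· ≥ ·) = rows := by
    change ((rows : Multiset ℕ)).sort (· ≥ ·) = rows
    rw [Multiset.coe_sort]
    exact List.mergeSort_of_pairwise (by simpa using h.1.pairwise)
  rw [YoungDiagram.mem_cells, diagram, YoungDiagram.mem_ofRowLens]
  simp only [hsort]

/-- The cells `(ρ i, κ i)` are the cells of a core if every other cell `(i, j)` of the diagram lies
in the top row, in a column that contains no core cell. -/
theorem exists_isCore {rows : List ℕ} (hp : IsPartitionOf rows n) (ρ κ : Fin m → ℕ)
    (hinj : ∀ i j, ρ i = ρ j → κ i = κ j → i = j)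
    (hmem : ∀ i, ∃ h : ρ i < rows.length, κ i < rows[ρ i])
    (hout : ∀ i (h : i < rows.length), ∀ j < rows[i], (∀ l, ρ l = i → κ l ≠ j) →
      i = 0 ∧ ∀ l, κ l ≠ j) :
    ∃ z : Fin m ↪ Fin n, IsCore (toPartition hp) z ρ κ := by
  set μ := toPartition hp
  have hmem' : ∀ i, (ρ i, κ i) ∈ (diagram μ).cells := fun i =>
    (mem_diagram_toPartition hp _).2 (hmem i)
  let z : Fin m ↪ Fin n := ⟨fun i => (tableau μ).symm ⟨_, hmem' i⟩, fun i j h => by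
    have h' := congrArg Subtype.val ((tableau μ).symm.injective h)
    exact hinj i j (congrArg Prod.fst h') (congrArg Prod.snd h')⟩
  have hz : ∀ i, (tableau μ (z i)).1 = (ρ i, κ i) := fun i =>
    congrArg Subtype.val ((tableau μ).apply_symm_apply ⟨_, hmem' i⟩)
  have hout' : ∀ x, x ∉ Set.range z → rowOf μ x = 0 ∧ ∀ l, κ l ≠ colOf μ x := fun x hx => by
    obtain ⟨h, hj⟩ := (mem_diagram_toPartition hp _).1 (tableau μ x).2
    exact hout _ h _ hj fun l hr hc =>
      hx ⟨l, (tableau μ).injective (Subtype.ext ((hz l).trans (Prod.ext hr hc)))⟩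
  have hrow : ∀ i, rowOf μ (z i) = ρ i := fun i => congrArg Prod.fst (hz i)
  have hcol : ∀ i, colOf μ (z i) = κ i := fun i => congrArg Prod.snd (hz i)
  refine ⟨z, hrow, hcol, fun x hx => (hout' x hx).1, fun x y hx hxy => ?_⟩
  by_cases hy : y ∈ Set.range z
  · obtain ⟨i, rfl⟩ := hy
    exact absurd ((hcol i).symm.trans hxy.symm) ((hout' x hx).2 i)
  · exact eq_of_rowOf_colOf ((hout' x hx).1.trans (hout' y hy).1.symm) hxy

end Criterion

/-! ### The six nontrivial characters -/

/-- The polynomial that expresses `χ^(n - 1, 1)` by the numbers `p`, `q`, `r` of cycles of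
lengths one, two and three. -/
noncomputable def polyOne (p _q _r : ℂ) : ℂ := p - 1

/-- The polynomial that expresses `χ^(n - 2, 2)` by the numbers `p`, `q`, `r` of cycles of
lengths one, two and three. -/
noncomputable def polyTwo (p q _r : ℂ) : ℂ := (p - 1) * (p - 2) / 2 + q - 1

/-- The polynomial that expresses `χ^(n - 2, 1, 1)` by the numbers `p`, `q`, `r` of cycles of
lengths one, two and three. -/
noncomputable def polyOneOne (p q _r : ℂ) : ℂ := (p - 1) * (p - 2) / 2 - q

/-- The polynomial that expresses `χ^(n - 3, 3)` by the numbers `p`, `q`, `r` of cycles of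
lengths one, two and three. -/
noncomputable def polyThree (p q r : ℂ) : ℂ :=
  (p - 1) * (p - 2) * (p - 3) / 6 + (p - 1) * (q - 1) + r

/-- The polynomial that expresses `χ^(n - 3, 2, 1)` by the numbers `p`, `q`, `r` of cycles of
lengths one, two and three. -/
noncomputable def polyTwoOne (p _q r : ℂ) : ℂ := 2 * ((p - 1) * (p - 2) * (p - 3) / 6) - p - r + 2

/-- The polynomial that expresses `χ^(n - 3, 1, 1, 1)` by the numbers `p`, `q`, `r` of cycles of
lengths one, two and three. -/
noncomputable def polyOneOneOne (p q r : ℂ) : ℂ := (p - 1) * (p - 2) * (p - 3) / 6 - q * (p - 1) + r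

/- Each of the next six pairs of lemmas treats one shape. The core consists of the cells below the
top row and of the top cells of the columns they meet; `![…]` lists the rows and the columns of its
cells. The first lemma expands the sum over the column group of the core, listed with signs, into
averages over the conjugacy class of `σ`; the constant in front of the polynomial is the product of
the hook lengths. The second one checks the normalization, for which only the sign and the numbers
of fixed points of the first three powers of each element of the column group are needed. -/

set_option maxHeartbeats 4000000 in
theorem sum_coreSum_sub_one_one {n : ℕ} (hn : 2 ≤ n) (z : Fin 2 ↪ Fin n)
    (σ : Equiv.Perm (Fin n)) :
    ∑ h : Equiv.Perm (Fin n), coreSum z ![0, 1] ![0, 0] σ h =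
      n.factorial / (n - 1) *
        polyOne (fixCount σ) (pts2 σ / 2) (pts3 σ / 3) := by
  have hL : (coreColGroup ![0, 0]).val.map
      (fun q => (((Equiv.Perm.sign q : ℤˣ) : ℤ), (⇑q : Fin 2 → Fin 2))) = ↑(
      [(1, ![0, 1]), (-1, ![1, 0])] :
        List (ℤ × (Fin 2 → Fin 2))) := by decide +kernel
  have h0 := cast_sub_ne_zero (n := n) (k := 0) (by omega)
  have h1 := cast_sub_ne_zero (n := n) (k := 1) (by omega)
  push_cast [sub_zero] at *
  have hsum : ∀ h, coreSum z ![0, 1] ![0, 0] σ h = _ := fun h =>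
    sum_eq_list_sum hL fun a => (a.1 : ℂ) * ∏ i with ![0, 1] i ≠ 0,
      ∑ l with ![0, 1] l = ![0, 1] i, entry σ h (z i) (z (a.2 l))
  simp only [hsum]
  simp [Finset.prod_filter, Finset.sum_filter, Fin.prod_univ_succ, Fin.sum_univ_succ]
  simp only [Finset.sum_add_distrib, Finset.sum_neg_distrib, sum_entry_one]
  simp (discharger := simp) only [avg_fix σ, avg_out σ (by omega : 2 ≤ n)]
  simp only [polyOne]
  field_simp
  ring

theorem irrChar_sub_one_one {n : ℕ} (hp : IsPartitionOf [n - 1, 1] n)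
    (σ : Equiv.Perm (Fin n)) : irrChar (toPartition hp) σ =
      polyOne (fixCount σ) (pts2 σ / 2) (pts3 σ / 3) := by
  have hn : 2 ≤ n := by
    have h1 := hp.1.pairwise
    have h2 := hp.2.2
    have h3 := hp.2.1
    simp at h1 h2 h3
    omega
  obtain ⟨z, hz⟩ := exists_isCore hp ![0, 1] ![0, 0] (by decide)
    (by simp [Fin.forall_fin_succ]; omega)
    (by
      intro i hi j hj hne
      simp [Fin.forall_fin_succ] at hi hj hne ⊢
      interval_cases i <;> simp at hj hne ⊢ <;> omega)
  refine irrChar_eq_of_core' (Q := fun p s t => polyOne p (s / 2) (t / 3)) hz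
    (sum_coreSum_sub_one_one hn z) ?_ σ
  have hL : (coreColGroup ![0, 0]).val.map (fun q =>
      (((Equiv.Perm.sign q : ℤˣ) : ℤ), fixCount q, fixCount (q * q), fixCount (q * q * q))) = ↑(
      [(1, 2, 2, 2), (-1, 0, 2, 0)] :
        List (ℤ × ℕ × ℕ × ℕ)) := by decide +kernel
  have hcard : (coreColGroup ![0, 0]).card = 2 := by decide +kernel
  rw [hcard]
  refine (sum_eq_list_sum hL fun a => (a.1 : ℂ) * polyOne (n - (2 : ℕ) + a.2.1)
    ((a.2.2.1 - a.2.1) / 2) ((a.2.2.2 - a.2.1) / 3)).trans ?_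
  simp [polyOne]

set_option maxHeartbeats 4000000 in
theorem sum_coreSum_sub_two_two {n : ℕ} (hn : 4 ≤ n) (z : Fin 4 ↪ Fin n)
    (σ : Equiv.Perm (Fin n)) :
    ∑ h : Equiv.Perm (Fin n), coreSum z ![0, 0, 1, 1] ![0, 1, 0, 1] σ h =
      n.factorial * 2 / (n * (n - 3)) *
        polyTwo (fixCount σ) (pts2 σ / 2) (pts3 σ / 3) := by
  have hL : (coreColGroup ![0, 1, 0, 1]).val.map
      (fun q => (((Equiv.Perm.sign q : ℤˣ) : ℤ), (⇑q : Fin 4 → Fin 4))) = ↑(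
      [(1, ![0, 1, 2, 3]), (-1, ![0, 3, 2, 1]), (-1, ![2, 1, 0, 3]), (1, ![2, 3, 0, 1])] :
        List (ℤ × (Fin 4 → Fin 4))) := by decide +kernel
  have h0 := cast_sub_ne_zero (n := n) (k := 0) (by omega)
  have h1 := cast_sub_ne_zero (n := n) (k := 1) (by omega)
  have h2 := cast_sub_ne_zero (n := n) (k := 2) (by omega)
  have h3 := cast_sub_ne_zero (n := n) (k := 3) (by omega)
  push_cast [sub_zero] at *
  have hsum : ∀ h, coreSum z ![0, 0, 1, 1] ![0, 1, 0, 1] σ h = _ := fun h =>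
    sum_eq_list_sum hL fun a => (a.1 : ℂ) * ∏ i with ![0, 0, 1, 1] i ≠ 0,
      ∑ l with ![0, 0, 1, 1] l = ![0, 0, 1, 1] i, entry σ h (z i) (z (a.2 l))
  simp only [hsum]
  simp [Finset.prod_filter, Finset.sum_filter, Fin.prod_univ_succ, Fin.sum_univ_succ]
  simp only [mul_add, add_mul, Finset.sum_add_distrib, Finset.sum_neg_distrib, sum_entry_two]
  simp (discharger := simp) only [avg_eq_zero₁₂]
  simp (discharger := simp) only [avg_order_fix, avg_order_path, List.cons_append, List.nil_append]
  simp (discharger := simp) only [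
    avg_fix_fix σ (by omega : 2 ≤ n), avg_two_cycle σ (by omega : 2 ≤ n),
    avg_fix_out σ (by omega : 3 ≤ n), avg_path σ (by omega : 3 ≤ n),
    avg_out_out σ (by omega : 4 ≤ n)]
  simp only [polyTwo]
  field_simp
  ring

theorem irrChar_sub_two_two {n : ℕ} (hp : IsPartitionOf [n - 2, 2] n)
    (σ : Equiv.Perm (Fin n)) : irrChar (toPartition hp) σ =
      polyTwo (fixCount σ) (pts2 σ / 2) (pts3 σ / 3) := by
  have hn : 4 ≤ n := by
    have h1 := hp.1.pairwise
    have h2 := hp.2.2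
    have h3 := hp.2.1
    simp at h1 h2 h3
    omega
  obtain ⟨z, hz⟩ := exists_isCore hp ![0, 0, 1, 1] ![0, 1, 0, 1] (by decide)
    (by simp [Fin.forall_fin_succ]; omega)
    (by
      intro i hi j hj hne
      simp [Fin.forall_fin_succ] at hi hj hne ⊢
      interval_cases i <;> simp at hj hne ⊢ <;> omega)
  refine irrChar_eq_of_core' (Q := fun p s t => polyTwo p (s / 2) (t / 3)) hz
    (sum_coreSum_sub_two_two hn z) ?_ σ
  have hL : (coreColGroup ![0, 1, 0, 1]).val.map (fun q =>
      (((Equiv.Perm.sign q : ℤˣ) : ℤ), fixCount q, fixCount (q * q), fixCount (q * q * q))) = ↑(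
      [(1, 4, 4, 4), (-1, 2, 4, 2), (-1, 2, 4, 2), (1, 0, 4, 0)] :
        List (ℤ × ℕ × ℕ × ℕ)) := by decide +kernel
  have hcard : (coreColGroup ![0, 1, 0, 1]).card = 4 := by decide +kernel
  rw [hcard]
  refine (sum_eq_list_sum hL fun a => (a.1 : ℂ) * polyTwo (n - (4 : ℕ) + a.2.1)
    ((a.2.2.1 - a.2.1) / 2) ((a.2.2.2 - a.2.1) / 3)).trans ?_
  simp [polyTwo]
  ring

set_option maxHeartbeats 4000000 in
theorem sum_coreSum_sub_two_one_one {n : ℕ} (hn : 3 ≤ n) (z : Fin 3 ↪ Fin n)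
    (σ : Equiv.Perm (Fin n)) :
    ∑ h : Equiv.Perm (Fin n), coreSum z ![0, 1, 2] ![0, 0, 0] σ h =
      n.factorial * 2 / ((n - 1) * (n - 2)) *
        polyOneOne (fixCount σ) (pts2 σ / 2) (pts3 σ / 3) := by
  have hL : (coreColGroup ![0, 0, 0]).val.map
      (fun q => (((Equiv.Perm.sign q : ℤˣ) : ℤ), (⇑q : Fin 3 → Fin 3))) = ↑(
      [(1, ![0, 1, 2]), (-1, ![0, 2, 1]), (-1, ![1, 0, 2]), (1, ![1, 2, 0]), (1, ![2, 0, 1]),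
       (-1, ![2, 1, 0])] :
        List (ℤ × (Fin 3 → Fin 3))) := by decide +kernel
  have h0 := cast_sub_ne_zero (n := n) (k := 0) (by omega)
  have h1 := cast_sub_ne_zero (n := n) (k := 1) (by omega)
  have h2 := cast_sub_ne_zero (n := n) (k := 2) (by omega)
  push_cast [sub_zero] at *
  have hsum : ∀ h, coreSum z ![0, 1, 2] ![0, 0, 0] σ h = _ := fun h =>
    sum_eq_list_sum hL fun a => (a.1 : ℂ) * ∏ i with ![0, 1, 2] i ≠ 0,
      ∑ l with ![0, 1, 2] l = ![0, 1, 2] i, entry σ h (z i) (z (a.2 l))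
  simp only [hsum]
  simp [Finset.prod_filter, Finset.sum_filter, Fin.prod_univ_succ, Fin.sum_univ_succ]
  simp only [Finset.sum_add_distrib, Finset.sum_neg_distrib, sum_entry_two]
  simp (discharger := simp) only [avg_order_fix, avg_order_path, List.cons_append, List.nil_append]
  simp (discharger := simp) only [
    avg_fix_fix σ (by omega : 2 ≤ n), avg_two_cycle σ (by omega : 2 ≤ n),
    avg_fix_out σ (by omega : 3 ≤ n), avg_path σ (by omega : 3 ≤ n)]
  simp only [polyOneOne]
  field_simp
  ring

theorem irrChar_sub_two_one_one {n : ℕ} (hp : IsPartitionOf [n - 2, 1, 1] n)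
    (σ : Equiv.Perm (Fin n)) : irrChar (toPartition hp) σ =
      polyOneOne (fixCount σ) (pts2 σ / 2) (pts3 σ / 3) := by
  have hn : 3 ≤ n := by
    have h1 := hp.1.pairwise
    have h2 := hp.2.2
    have h3 := hp.2.1
    simp at h1 h2 h3
    omega
  obtain ⟨z, hz⟩ := exists_isCore hp ![0, 1, 2] ![0, 0, 0] (by decide)
    (by simp [Fin.forall_fin_succ]; omega)
    (by
      intro i hi j hj hne
      simp [Fin.forall_fin_succ] at hi hj hne ⊢
      interval_cases i <;> simp at hj hne ⊢ <;> omega)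
  refine irrChar_eq_of_core' (Q := fun p s t => polyOneOne p (s / 2) (t / 3)) hz
    (sum_coreSum_sub_two_one_one hn z) ?_ σ
  have hL : (coreColGroup ![0, 0, 0]).val.map (fun q =>
      (((Equiv.Perm.sign q : ℤˣ) : ℤ), fixCount q, fixCount (q * q), fixCount (q * q * q))) = ↑(
      [(1, 3, 3, 3), (-1, 1, 3, 1), (-1, 1, 3, 1), (1, 0, 0, 3), (1, 0, 0, 3), (-1, 1, 3, 1)] :
        List (ℤ × ℕ × ℕ × ℕ)) := by decide +kernel
  have hcard : (coreColGroup ![0, 0, 0]).card = 6 := by decide +kernel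
  rw [hcard]
  refine (sum_eq_list_sum hL fun a => (a.1 : ℂ) * polyOneOne (n - (3 : ℕ) + a.2.1)
    ((a.2.2.1 - a.2.1) / 2) ((a.2.2.2 - a.2.1) / 3)).trans ?_
  simp [polyOneOne]
  ring

set_option maxHeartbeats 4000000 in
theorem sum_coreSum_sub_three_three {n : ℕ} (hn : 6 ≤ n) (z : Fin 6 ↪ Fin n)
    (σ : Equiv.Perm (Fin n)) :
    ∑ h : Equiv.Perm (Fin n), coreSum z ![0, 0, 0, 1, 1, 1] ![0, 1, 2, 0, 1, 2] σ h =
      n.factorial * 6 / (n * (n - 1) * (n - 5)) *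
        polyThree (fixCount σ) (pts2 σ / 2) (pts3 σ / 3) := by
  have hL : (coreColGroup ![0, 1, 2, 0, 1, 2]).val.map
      (fun q => (((Equiv.Perm.sign q : ℤˣ) : ℤ), (⇑q : Fin 6 → Fin 6))) = ↑(
      [(1, ![0, 1, 2, 3, 4, 5]), (-1, ![0, 1, 5, 3, 4, 2]), (-1, ![0, 4, 2, 3, 1, 5]),
       (1, ![0, 4, 5, 3, 1, 2]), (-1, ![3, 1, 2, 0, 4, 5]), (1, ![3, 1, 5, 0, 4, 2]),
       (1, ![3, 4, 2, 0, 1, 5]), (-1, ![3, 4, 5, 0, 1, 2])] :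
        List (ℤ × (Fin 6 → Fin 6))) := by decide +kernel
  have h0 := cast_sub_ne_zero (n := n) (k := 0) (by omega)
  have h1 := cast_sub_ne_zero (n := n) (k := 1) (by omega)
  have h2 := cast_sub_ne_zero (n := n) (k := 2) (by omega)
  have h3 := cast_sub_ne_zero (n := n) (k := 3) (by omega)
  have h4 := cast_sub_ne_zero (n := n) (k := 4) (by omega)
  have h5 := cast_sub_ne_zero (n := n) (k := 5) (by omega)
  push_cast [sub_zero] at *
  have hsum : ∀ h, coreSum z ![0, 0, 0, 1, 1, 1] ![0, 1, 2, 0, 1, 2] σ h = _ := fun h =>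
    sum_eq_list_sum hL fun a => (a.1 : ℂ) * ∏ i with ![0, 0, 0, 1, 1, 1] i ≠ 0,
      ∑ l with ![0, 0, 0, 1, 1, 1] l = ![0, 0, 0, 1, 1, 1] i, entry σ h (z i) (z (a.2 l))
  simp only [hsum]
  simp [Finset.prod_filter, Finset.sum_filter, Fin.prod_univ_succ, Fin.sum_univ_succ]
  simp only [mul_add, add_mul, ← mul_assoc, Finset.sum_add_distrib, Finset.sum_neg_distrib,
             sum_entry_three]
  simp (discharger := simp) only [avg_eq_zero₁₂, avg_eq_zero₁₃, avg_eq_zero₂₃]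
  simp (discharger := simp) only [avg_order_fix, avg_order_fix', avg_order_path, avg_order_path',
    avg_order_path_path, avg_order_path_out, avg_order_path_out', avg_order_out_path,
    List.cons_append, List.nil_append]
  simp (discharger := simp) only [
    avg_fix_fix_fix σ (by omega : 3 ≤ n), avg_fix_two_cycle σ (by omega : 3 ≤ n),
    avg_three_cycle σ (by omega : 3 ≤ n), avg_fix_fix_out σ (by omega : 4 ≤ n),
    avg_two_cycle_out σ (by omega : 4 ≤ n), avg_fix_path σ (by omega : 4 ≤ n),
    avg_path_path σ (by omega : 4 ≤ n), avg_fix_out_out σ (by omega : 5 ≤ n),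
    avg_path_out σ (by omega : 5 ≤ n), avg_out_out_out σ (by omega : 6 ≤ n)]
  simp only [polyThree]
  field_simp
  ring

theorem irrChar_sub_three_three {n : ℕ} (hp : IsPartitionOf [n - 3, 3] n)
    (σ : Equiv.Perm (Fin n)) : irrChar (toPartition hp) σ =
      polyThree (fixCount σ) (pts2 σ / 2) (pts3 σ / 3) := by
  have hn : 6 ≤ n := by
    have h1 := hp.1.pairwise
    have h2 := hp.2.2
    have h3 := hp.2.1
    simp at h1 h2 h3
    omega
  obtain ⟨z, hz⟩ := exists_isCore hp ![0, 0, 0, 1, 1, 1] ![0, 1, 2, 0, 1, 2] (by decide)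
    (by simp [Fin.forall_fin_succ]; omega)
    (by
      intro i hi j hj hne
      simp [Fin.forall_fin_succ] at hi hj hne ⊢
      interval_cases i <;> simp at hj hne ⊢ <;> omega)
  refine irrChar_eq_of_core' (Q := fun p s t => polyThree p (s / 2) (t / 3)) hz
    (sum_coreSum_sub_three_three hn z) ?_ σ
  have hL : (coreColGroup ![0, 1, 2, 0, 1, 2]).val.map (fun q =>
      (((Equiv.Perm.sign q : ℤˣ) : ℤ), fixCount q, fixCount (q * q), fixCount (q * q * q))) = ↑(
      [(1, 6, 6, 6), (-1, 4, 6, 4), (-1, 4, 6, 4), (1, 2, 6, 2), (-1, 4, 6, 4), (1, 2, 6, 2),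
       (1, 2, 6, 2), (-1, 0, 6, 0)] :
        List (ℤ × ℕ × ℕ × ℕ)) := by decide +kernel
  have hcard : (coreColGroup ![0, 1, 2, 0, 1, 2]).card = 8 := by decide +kernel
  rw [hcard]
  refine (sum_eq_list_sum hL fun a => (a.1 : ℂ) * polyThree (n - (6 : ℕ) + a.2.1)
    ((a.2.2.1 - a.2.1) / 2) ((a.2.2.2 - a.2.1) / 3)).trans ?_
  simp [polyThree]
  ring

set_option maxHeartbeats 4000000 in
theorem sum_coreSum_sub_three_two_one {n : ℕ} (hn : 5 ≤ n) (z : Fin 5 ↪ Fin n)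
    (σ : Equiv.Perm (Fin n)) :
    ∑ h : Equiv.Perm (Fin n), coreSum z ![0, 0, 1, 1, 2] ![0, 1, 0, 1, 0] σ h =
      n.factorial * 3 / (n * (n - 2) * (n - 4)) *
        polyTwoOne (fixCount σ) (pts2 σ / 2) (pts3 σ / 3) := by
  have hL : (coreColGroup ![0, 1, 0, 1, 0]).val.map
      (fun q => (((Equiv.Perm.sign q : ℤˣ) : ℤ), (⇑q : Fin 5 → Fin 5))) = ↑(
      [(1, ![0, 1, 2, 3, 4]), (-1, ![0, 1, 4, 3, 2]), (-1, ![0, 3, 2, 1, 4]),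
       (1, ![0, 3, 4, 1, 2]), (-1, ![2, 1, 0, 3, 4]), (1, ![2, 1, 4, 3, 0]), (1, ![2, 3, 0, 1, 4]),
       (-1, ![2, 3, 4, 1, 0]), (1, ![4, 1, 0, 3, 2]), (-1, ![4, 1, 2, 3, 0]),
       (-1, ![4, 3, 0, 1, 2]), (1, ![4, 3, 2, 1, 0])] :
        List (ℤ × (Fin 5 → Fin 5))) := by decide +kernel
  have h0 := cast_sub_ne_zero (n := n) (k := 0) (by omega)
  have h1 := cast_sub_ne_zero (n := n) (k := 1) (by omega)
  have h2 := cast_sub_ne_zero (n := n) (k := 2) (by omega)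
  have h3 := cast_sub_ne_zero (n := n) (k := 3) (by omega)
  have h4 := cast_sub_ne_zero (n := n) (k := 4) (by omega)
  push_cast [sub_zero] at *
  have hsum : ∀ h, coreSum z ![0, 0, 1, 1, 2] ![0, 1, 0, 1, 0] σ h = _ := fun h =>
    sum_eq_list_sum hL fun a => (a.1 : ℂ) * ∏ i with ![0, 0, 1, 1, 2] i ≠ 0,
      ∑ l with ![0, 0, 1, 1, 2] l = ![0, 0, 1, 1, 2] i, entry σ h (z i) (z (a.2 l))
  simp only [hsum]
  simp [Finset.prod_filter, Finset.sum_filter, Fin.prod_univ_succ, Fin.sum_univ_succ]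
  simp only [mul_add, add_mul, ← mul_assoc, Finset.sum_add_distrib, Finset.sum_neg_distrib,
             sum_entry_three]
  simp (discharger := simp) only [avg_eq_zero₁₂]
  simp (discharger := simp) only [avg_order_fix, avg_order_fix', avg_order_path, avg_order_path',
    avg_order_path_path, avg_order_path_out, avg_order_path_out', avg_order_out_path,
    List.cons_append, List.nil_append]
  simp (discharger := simp) only [
    avg_fix_fix_fix σ (by omega : 3 ≤ n), avg_fix_two_cycle σ (by omega : 3 ≤ n),
    avg_three_cycle σ (by omega : 3 ≤ n), avg_fix_fix_out σ (by omega : 4 ≤ n),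
    avg_two_cycle_out σ (by omega : 4 ≤ n), avg_fix_path σ (by omega : 4 ≤ n),
    avg_path_path σ (by omega : 4 ≤ n), avg_fix_out_out σ (by omega : 5 ≤ n),
    avg_path_out σ (by omega : 5 ≤ n)]
  simp only [polyTwoOne]
  field_simp
  ring

theorem irrChar_sub_three_two_one {n : ℕ} (hp : IsPartitionOf [n - 3, 2, 1] n)
    (σ : Equiv.Perm (Fin n)) : irrChar (toPartition hp) σ =
      polyTwoOne (fixCount σ) (pts2 σ / 2) (pts3 σ / 3) := by
  have hn : 5 ≤ n := by
    have h1 := hp.1.pairwise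
    have h2 := hp.2.2
    have h3 := hp.2.1
    simp at h1 h2 h3
    omega
  obtain ⟨z, hz⟩ := exists_isCore hp ![0, 0, 1, 1, 2] ![0, 1, 0, 1, 0] (by decide)
    (by simp [Fin.forall_fin_succ]; omega)
    (by
      intro i hi j hj hne
      simp [Fin.forall_fin_succ] at hi hj hne ⊢
      interval_cases i <;> simp at hj hne ⊢ <;> omega)
  refine irrChar_eq_of_core' (Q := fun p s t => polyTwoOne p (s / 2) (t / 3)) hz
    (sum_coreSum_sub_three_two_one hn z) ?_ σ
  have hL : (coreColGroup ![0, 1, 0, 1, 0]).val.map (fun q =>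
      (((Equiv.Perm.sign q : ℤˣ) : ℤ), fixCount q, fixCount (q * q), fixCount (q * q * q))) = ↑(
      [(1, 5, 5, 5), (-1, 3, 5, 3), (-1, 3, 5, 3), (1, 1, 5, 1), (-1, 3, 5, 3), (1, 2, 2, 5),
       (1, 1, 5, 1), (-1, 0, 2, 3), (1, 2, 2, 5), (-1, 3, 5, 3), (-1, 0, 2, 3), (1, 1, 5, 1)] :
        List (ℤ × ℕ × ℕ × ℕ)) := by decide +kernel
  have hcard : (coreColGroup ![0, 1, 0, 1, 0]).card = 12 := by decide +kernel
  rw [hcard]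
  refine (sum_eq_list_sum hL fun a => (a.1 : ℂ) * polyTwoOne (n - (5 : ℕ) + a.2.1)
    ((a.2.2.1 - a.2.1) / 2) ((a.2.2.2 - a.2.1) / 3)).trans ?_
  simp [polyTwoOne]
  ring

set_option maxHeartbeats 4000000 in
theorem sum_coreSum_sub_three_one_one_one {n : ℕ} (hn : 4 ≤ n) (z : Fin 4 ↪ Fin n)
    (σ : Equiv.Perm (Fin n)) :
    ∑ h : Equiv.Perm (Fin n), coreSum z ![0, 1, 2, 3] ![0, 0, 0, 0] σ h =
      n.factorial * 6 / ((n - 1) * (n - 2) * (n - 3)) *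
        polyOneOneOne (fixCount σ) (pts2 σ / 2) (pts3 σ / 3) := by
  have hL : (coreColGroup ![0, 0, 0, 0]).val.map
      (fun q => (((Equiv.Perm.sign q : ℤˣ) : ℤ), (⇑q : Fin 4 → Fin 4))) = ↑(
      [(1, ![0, 1, 2, 3]), (-1, ![0, 1, 3, 2]), (-1, ![0, 2, 1, 3]), (1, ![0, 2, 3, 1]),
       (1, ![0, 3, 1, 2]), (-1, ![0, 3, 2, 1]), (-1, ![1, 0, 2, 3]), (1, ![1, 0, 3, 2]),
       (1, ![1, 2, 0, 3]), (-1, ![1, 2, 3, 0]), (-1, ![1, 3, 0, 2]), (1, ![1, 3, 2, 0]),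
       (1, ![2, 0, 1, 3]), (-1, ![2, 0, 3, 1]), (-1, ![2, 1, 0, 3]), (1, ![2, 1, 3, 0]),
       (1, ![2, 3, 0, 1]), (-1, ![2, 3, 1, 0]), (-1, ![3, 0, 1, 2]), (1, ![3, 0, 2, 1]),
       (1, ![3, 1, 0, 2]), (-1, ![3, 1, 2, 0]), (-1, ![3, 2, 0, 1]), (1, ![3, 2, 1, 0])] :
        List (ℤ × (Fin 4 → Fin 4))) := by decide +kernel
  have h0 := cast_sub_ne_zero (n := n) (k := 0) (by omega)
  have h1 := cast_sub_ne_zero (n := n) (k := 1) (by omega)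
  have h2 := cast_sub_ne_zero (n := n) (k := 2) (by omega)
  have h3 := cast_sub_ne_zero (n := n) (k := 3) (by omega)
  push_cast [sub_zero] at *
  have hsum : ∀ h, coreSum z ![0, 1, 2, 3] ![0, 0, 0, 0] σ h = _ := fun h =>
    sum_eq_list_sum hL fun a => (a.1 : ℂ) * ∏ i with ![0, 1, 2, 3] i ≠ 0,
      ∑ l with ![0, 1, 2, 3] l = ![0, 1, 2, 3] i, entry σ h (z i) (z (a.2 l))
  simp only [hsum]
  simp [Finset.prod_filter, Finset.sum_filter, Fin.prod_univ_succ, Fin.sum_univ_succ]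
  simp only [← mul_assoc, Finset.sum_add_distrib, Finset.sum_neg_distrib, sum_entry_three]
  simp (discharger := simp) only [avg_order_fix, avg_order_fix', avg_order_path, avg_order_path',
    avg_order_path_path, avg_order_path_out, avg_order_path_out', avg_order_out_path,
    List.cons_append, List.nil_append]
  simp (discharger := simp) only [
    avg_fix_fix_fix σ (by omega : 3 ≤ n), avg_fix_two_cycle σ (by omega : 3 ≤ n),
    avg_three_cycle σ (by omega : 3 ≤ n), avg_fix_fix_out σ (by omega : 4 ≤ n),
    avg_two_cycle_out σ (by omega : 4 ≤ n), avg_fix_path σ (by omega : 4 ≤ n),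
    avg_path_path σ (by omega : 4 ≤ n)]
  simp only [polyOneOneOne]
  field_simp
  ring

theorem irrChar_sub_three_one_one_one {n : ℕ} (hp : IsPartitionOf [n - 3, 1, 1, 1] n)
    (σ : Equiv.Perm (Fin n)) : irrChar (toPartition hp) σ =
      polyOneOneOne (fixCount σ) (pts2 σ / 2) (pts3 σ / 3) := by
  have hn : 4 ≤ n := by
    have h1 := hp.1.pairwise
    have h2 := hp.2.2
    have h3 := hp.2.1
    simp at h1 h2 h3
    omega
  obtain ⟨z, hz⟩ := exists_isCore hp ![0, 1, 2, 3] ![0, 0, 0, 0] (by decide)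
    (by simp [Fin.forall_fin_succ]; omega)
    (by
      intro i hi j hj hne
      simp [Fin.forall_fin_succ] at hi hj hne ⊢
      interval_cases i <;> simp at hj hne ⊢ <;> omega)
  refine irrChar_eq_of_core' (Q := fun p s t => polyOneOneOne p (s / 2) (t / 3)) hz
    (sum_coreSum_sub_three_one_one_one hn z) ?_ σ
  have hL : (coreColGroup ![0, 0, 0, 0]).val.map (fun q =>
      (((Equiv.Perm.sign q : ℤˣ) : ℤ), fixCount q, fixCount (q * q), fixCount (q * q * q))) = ↑(
      [(1, 4, 4, 4), (-1, 2, 4, 2), (-1, 2, 4, 2), (1, 1, 1, 4), (1, 1, 1, 4), (-1, 2, 4, 2),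
       (-1, 2, 4, 2), (1, 0, 4, 0), (1, 1, 1, 4), (-1, 0, 0, 0), (-1, 0, 0, 0), (1, 1, 1, 4),
       (1, 1, 1, 4), (-1, 0, 0, 0), (-1, 2, 4, 2), (1, 1, 1, 4), (1, 0, 4, 0), (-1, 0, 0, 0),
       (-1, 0, 0, 0), (1, 1, 1, 4), (1, 1, 1, 4), (-1, 2, 4, 2), (-1, 0, 0, 0), (1, 0, 4, 0)] :
        List (ℤ × ℕ × ℕ × ℕ)) := by decide +kernel
  have hcard : (coreColGroup ![0, 0, 0, 0]).card = 24 := by decide +kernel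
  rw [hcard]
  refine (sum_eq_list_sum hL fun a => (a.1 : ℂ) * polyOneOneOne (n - (4 : ℕ) + a.2.1)
    ((a.2.2.1 - a.2.1) / 2) ((a.2.2.2 - a.2.1) / 3)).trans ?_
  simp [polyOneOneOne]
  ring

/-! ### Numbers of cycles -/

theorem mul_count_cycleType {n : ℕ} (σ : Equiv.Perm (Fin n)) (k : ℕ) :
    k * σ.cycleType.count k =
      (Finset.univ.filter fun x => σ x ≠ x ∧ (σ.cycleOf x).support.card = k).card := by
  have hmap : ∀ x ∈ Finset.univ.filter fun x => σ x ≠ x ∧ (σ.cycleOf x).support.card = k,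
      σ.cycleOf x ∈ σ.cycleFactorsFinset.filter fun c => c.support.card = k := by
    intro x hx
    simpa [Equiv.Perm.cycleOf_mem_cycleFactorsFinset_iff] using hx
  rw [Finset.card_eq_sum_card_fiberwise hmap, Finset.sum_const_nat (m := k), mul_comm,
    Equiv.Perm.cycleType_def, Multiset.count_map]
  · congr 2
    ext c
    simp [eq_comm]
  · intro c hc
    obtain ⟨hc, hk⟩ := Finset.mem_filter.1 hc
    rw [← hk]
    congr 1
    ext x
    have h : x ∈ c.support ↔ σ x ≠ x ∧ σ.cycleOf x = c := by
      constructor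
      · intro hx
        exact ⟨Equiv.Perm.mem_support.1 (Equiv.Perm.mem_cycleFactorsFinset_support_le hc hx),
          (Equiv.Perm.cycle_is_cycleOf hx hc).symm⟩
      · rintro ⟨hx, rfl⟩
        exact Equiv.Perm.mem_support_cycleOf_iff.2 ⟨.refl _ _, Equiv.Perm.mem_support.2 hx⟩
    rw [h]
    simp only [Finset.mem_filter, Finset.mem_univ, true_and]
    constructor
    · rintro ⟨⟨h1, -⟩, h2⟩
      exact ⟨h1, h2⟩
    · rintro ⟨h1, rfl⟩
      exact ⟨⟨h1, rfl⟩, rfl⟩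

theorem cycles_one {n : ℕ} (σ : Equiv.Perm (Fin n)) : cycles 1 σ = fixCount σ := by
  rw [cycles, Equiv.Perm.parts_partition, Multiset.count_add, Multiset.count_replicate_self,
    Multiset.count_eq_zero_of_notMem fun h => (Equiv.Perm.one_lt_of_mem_cycleType h).false,
    zero_add, ← Finset.card_compl, fixCount]
  congr 1
  ext x
  simp

/-- For a prime `k`, the points on `k`-cycles are those fixed by the `k`-th power of the permutation
but not by the permutation itself. -/
theorem mul_cycles {n k : ℕ} (hk : k.Prime) (σ : Equiv.Perm (Fin n)) :
    k * cycles k σ + fixCount σ = fixCount (σ ^ k) := by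
  rw [cycles, Equiv.Perm.parts_partition, Multiset.count_add, Multiset.count_replicate,
    if_neg hk.one_lt.ne, add_zero, mul_count_cycleType, fixCount, fixCount,
    ← Finset.card_union_of_disjoint]
  · congr 1
    ext x
    by_cases hx : σ x = x
    · simp [hx, Equiv.Perm.pow_apply_eq_self_of_apply_eq_self]
    · have hs : x ∈ (σ.cycleOf x).support :=
        Equiv.Perm.mem_support_cycleOf_iff.2 ⟨.refl _ _, Equiv.Perm.mem_support.2 hx⟩
      have h1 : (σ.cycleOf x).support.card ≠ 1 := Equiv.Perm.card_support_ne_one _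
      simp [hx, (σ.isCycleOn_support_cycleOf x).pow_apply_eq hs, Nat.dvd_prime hk, h1]
  · rw [Finset.disjoint_filter]
    rintro x - h1 h2
    exact h1.1 h2

theorem cycles_two {n : ℕ} (σ : Equiv.Perm (Fin n)) : (cycles 2 σ : ℂ) = pts2 σ / 2 := by
  have h : (2 * cycles 2 σ + fixCount σ : ℂ) = fixCount (σ * σ) := by
    exact_mod_cast pow_two σ ▸ mul_cycles Nat.prime_two σ
  rw [pts2, ← h]
  ring

theorem cycles_three {n : ℕ} (σ : Equiv.Perm (Fin n)) : (cycles 3 σ : ℂ) = pts3 σ / 3 := by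
  have h : (3 * cycles 3 σ + fixCount σ : ℂ) = fixCount (σ * σ * σ) := by
    exact_mod_cast pow_three' σ ▸ mul_cycles Nat.prime_three σ
  rw [pts3, ← h]
  ring

/-! ### The vector of characters as a vector of polynomials -/

/-- The shape is a single row, so the empty core suffices. -/
theorem irrChar_row {n : ℕ} (hp : IsPartitionOf [n] n) (σ : Equiv.Perm (Fin n)) :
    irrChar (toPartition hp) σ = 1 := by
  obtain ⟨z, hz⟩ := exists_isCore hp ![] ![] (by decide) (by simp) (by simp)
  refine irrChar_eq_of_core' (K := n.factorial) (Q := fun _ _ _ => 1) hz (fun σ => ?_) ?_ σ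
  · have h : ∀ h, coreSum z ![] ![] σ h = 1 := fun h => by
      rw [coreSum, show coreColGroup ![] = {1} by decide +kernel]
      simp
    simp [h, Fintype.card_perm]
  · rw [show coreColGroup ![] = {1} by decide +kernel]
    simp

theorem chiOr_eq {n : ℕ} {rows : List ℕ} {other f : Equiv.Perm (Fin n) → ℂ}
    {σ : Equiv.Perm (Fin n)} (h1 : ∀ h : IsPartitionOf rows n, irrChar (toPartition h) σ = f σ)
    (h2 : other σ = f σ) : chiOr rows other σ = f σ := by
  rw [chiOr]
  split_ifs with h
  exacts [h1 h, h2]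

/-- Every entry of the vector of characters is given by its polynomial, whether or not its index is
a partition. -/
theorem chi7_eq (n : ℕ) (σ : Equiv.Perm (Fin n)) {p q r : ℂ} (hp : cycles 1 σ = p)
    (hq : cycles 2 σ = q) (hr : cycles 3 σ = r) :
    chi7 n σ = ![1, polyOne p q r, polyTwo p q r, polyOneOne p q r, polyThree p q r,
      polyTwoOne p q r, polyOneOneOne p q r] := by
  have h : ∀ (Q : ℂ → ℂ → ℂ → ℂ) rows other,
      (∀ h : IsPartitionOf rows n, irrChar (toPartition h) σ =
        Q (fixCount σ) (pts2 σ / 2) (pts3 σ / 3)) →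
      other σ = Q p q r → chiOr rows other σ = Q p q r := by
    intro Q rows other h1 h2
    refine chiOr_eq (f := fun _ => Q p q r) (fun h => ?_) h2
    rw [h1, ← hp, ← hq, ← hr, cycles_one, cycles_two, cycles_three]
  rw [chi7, h (fun _ _ _ => 1) _ _ (irrChar_row · σ) rfl,
    h polyOne _ _ (irrChar_sub_one_one · σ) (by rw [hp]; rfl),
    h polyTwo _ _ (irrChar_sub_two_two · σ) (by rw [hp, hq]; rfl),
    h polyOneOne _ _ (irrChar_sub_two_one_one · σ) (by rw [hp, hq]; rfl),
    h polyThree _ _ (irrChar_sub_three_three · σ) (by rw [hp, hq, hr]; rfl),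
    h polyTwoOne _ _ (irrChar_sub_three_two_one · σ) (by rw [hp, hr]; rfl),
    h polyOneOneOne _ _ (irrChar_sub_three_one_one_one · σ) (by rw [hp, hq, hr]; rfl)]

/-- The parts of size at least four have sum zero or at least four. -/
theorem sum_eq_or_add_four_le_sum (s : Multiset ℕ) (hs : ∀ i ∈ s, 0 < i) :
    s.count 1 + 2 * s.count 2 + 3 * s.count 3 = s.sum ∨
      s.count 1 + 2 * s.count 2 + 3 * s.count 3 + 4 ≤ s.sum := by
  induction s using Multiset.induction with
  | empty => simp
  | cons a s ih =>
    have h := ih fun i hi => hs i (Multiset.mem_cons_of_mem hi)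
    have ha := hs a (Multiset.mem_cons_self a s)
    simp only [Multiset.count_cons, Multiset.sum_cons]
    split_ifs <;> omega

/- The next three lemmas list the possible triples of the numbers of parts of sizes one, two
and three. -/

theorem parts_count_three (lam : Nat.Partition 3) :
    (lam.parts.count 1, lam.parts.count 2, lam.parts.count 3) ∈
      ([(3, 0, 0), (1, 1, 0), (0, 0, 1)] : List (ℕ × ℕ × ℕ)) := by
  have h := sum_eq_or_add_four_le_sum lam.parts fun _ => lam.parts_pos
  rw [lam.parts_sum] at h
  generalize lam.parts.count 1 = p at *
  generalize lam.parts.count 2 = q at *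
  generalize lam.parts.count 3 = r at *
  have hq : q ≤ 2 := by omega
  have hr : r ≤ 1 := by omega
  interval_cases q <;> interval_cases r <;> simp <;> omega

theorem parts_count_four (lam : Nat.Partition 4) :
    (lam.parts.count 1, lam.parts.count 2, lam.parts.count 3) ∈
      ([(4, 0, 0), (2, 1, 0), (0, 2, 0), (1, 0, 1), (0, 0, 0)] : List (ℕ × ℕ × ℕ)) := by
  have h := sum_eq_or_add_four_le_sum lam.parts fun _ => lam.parts_pos
  rw [lam.parts_sum] at h
  generalize lam.parts.count 1 = p at *
  generalize lam.parts.count 2 = q at *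
  generalize lam.parts.count 3 = r at *
  have hq : q ≤ 2 := by omega
  have hr : r ≤ 1 := by omega
  interval_cases q <;> interval_cases r <;> simp <;> omega

theorem parts_count_five (lam : Nat.Partition 5) :
    (lam.parts.count 1, lam.parts.count 2, lam.parts.count 3) ∈
      ([(5, 0, 0), (3, 1, 0), (1, 2, 0), (2, 0, 1), (0, 1, 1), (1, 0, 0), (0, 0, 0)] :
        List (ℕ × ℕ × ℕ)) := by
  have h := sum_eq_or_add_four_le_sum lam.parts fun _ => lam.parts_pos
  rw [lam.parts_sum] at h
  generalize lam.parts.count 1 = p at *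
  generalize lam.parts.count 2 = q at *
  generalize lam.parts.count 3 = r at *
  have hq : q ≤ 2 := by omega
  have hr : r ≤ 1 := by omega
  interval_cases q <;> interval_cases r <;> simp <;> omega

end SymChar

theorem mainTheorem4 (n : ℕ) (hn : 3 ≤ n) (lam : n.Partition) (σ : Equiv.Perm (Fin n))
    (hσ : σ.partition.parts = lam.parts) :
    (SymChar.H31 lam = ![(1 : ℂ), 3, 3, 3, 1, 2, 1] ⬝ᵥ SymChar.chi7 n σ ∧
      SymChar.H32 lam = ![(1 : ℂ), 1, 1, -1, 1, 0, -1] ⬝ᵥ SymChar.chi7 n σ ∧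
      SymChar.H33 lam = ![(1 : ℂ), 0, 0, 0, 1, -1, 1] ⬝ᵥ SymChar.chi7 n σ ∧
      SymChar.H41 lam = ![(n : ℂ) - 3, 2 * (n : ℂ) - 7, (n : ℂ) - 5, (n : ℂ) - 5, -1, -2, -1] ⬝ᵥ
        SymChar.chi7 n σ ∧
      SymChar.H42 lam = ![(n : ℂ) - 3, -1, (n : ℂ) - 3, -(n : ℂ) + 3, -1, 0, 1] ⬝ᵥ
        SymChar.chi7 n σ ∧
      SymChar.H43 lam = ![(n : ℂ) - 3, (n : ℂ) - 4, -2, 0, -1, 0, 1] ⬝ᵥ SymChar.chi7 n σ ∧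
      SymChar.H44 lam = ![(n : ℂ) - 3, -1, -1, 1, -1, 1, -1] ⬝ᵥ SymChar.chi7 n σ ∧
      SymChar.H51 lam =
        ![(n : ℂ) ^ 2 - 7 * (n : ℂ) + 12, (n : ℂ) ^ 2 - 9 * (n : ℂ) + 20, -2 * (n : ℂ) + 10,
            -2 * (n : ℂ) + 8, 2, 2, 0] ⬝ᵥ
          SymChar.chi7 n σ ∧
      SymChar.H52 lam =
        ![(n : ℂ) ^ 2 - 7 * (n : ℂ) + 12, -2 * (n : ℂ) + 8, -(n : ℂ) + 6, (n : ℂ) - 4, 2, -1, 0] ⬝ᵥ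
          SymChar.chi7 n σ ∧
      SymChar.H61 lam =
        ![(n : ℂ) ^ 3 - 12 * (n : ℂ) ^ 2 + 47 * (n : ℂ) - 60, -3 * (n : ℂ) ^ 2 + 27 * (n : ℂ) - 60,
            6 * (n : ℂ) - 30, 0, -6, 0, 0] ⬝ᵥ
          SymChar.chi7 n σ) ∧
    (n = 5 → SymChar.chi7 n σ 4 = 0) ∧
    (n = 4 → SymChar.chi7 n σ 4 = -SymChar.chi7 n σ 2 ∧ SymChar.chi7 n σ 5 = 0) ∧
    (n = 3 → SymChar.chi7 n σ 2 = 0 ∧ SymChar.chi7 n σ 4 = -SymChar.chi7 n σ 1 ∧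
      SymChar.chi7 n σ 5 = -SymChar.chi7 n σ 3 ∧ SymChar.chi7 n σ 6 = 0) := by
  have hk : ∀ k, (SymChar.cycles k σ : ℂ) = SymChar.mult lam k := fun k => by
    rw [SymChar.cycles, hσ, SymChar.mult]
  rw [SymChar.chi7_eq n σ (hk 1) (hk 2) (hk 3)]
  simp only [SymChar.H31, SymChar.H32, SymChar.H33, SymChar.H41, SymChar.H42, SymChar.H43,
    SymChar.H44, SymChar.H51, SymChar.H52, SymChar.H61, SymChar.polyOne, SymChar.polyTwo,
    SymChar.polyOneOne, SymChar.polyThree, SymChar.polyTwoOne, SymChar.polyOneOneOne]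
  refine ⟨?_, ?_, ?_, ?_⟩
  · generalize SymChar.mult lam 1 = p
    generalize SymChar.mult lam 2 = q
    generalize SymChar.mult lam 3 = r
    simp only [Matrix.cons_dotProduct_cons, Matrix.dotProduct_of_isEmpty]
    refine ⟨?_, ?_, ?_, ?_, ?_, ?_, ?_, ?_, ?_, ?_⟩ <;> ring
  -- For `n ≤ 5`, the entries in question are compared on each of the possible cycle types.
  · rintro rfl
    have h := SymChar.parts_count_five lam
    simp only [List.mem_cons, Prod.mk.injEq, List.not_mem_nil, or_false] at h
    rcases h with h | h | h | h | h | h | h <;>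
      simp [SymChar.mult, h] <;> norm_num
  · rintro rfl
    have h := SymChar.parts_count_four lam
    simp only [List.mem_cons, Prod.mk.injEq, List.not_mem_nil, or_false] at h
    rcases h with h | h | h | h | h <;>
      simp [SymChar.mult, h] <;> norm_num
  · rintro rfl
    have h := SymChar.parts_count_three lam
    simp only [List.mem_cons, Prod.mk.injEq, List.not_mem_nil, or_false] at h
    rcases h with h | h | h <;>
      simp [SymChar.mult, h] <;> norm_num
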